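/- Let $k$ be an algebraically closed field, $S=k[X_0,\dots,X_N]$ and $\mathbb P^N=\mathbb P^N_k=\operatorname{Proj} S$. For a nonempty closed subscheme $X\subseteq\mathbb P^N$ with ideal sheaf $\mathcal I_X$ let $I_X=\bigoplus_{n}H^0(\mathbb P^N,\mathcal I_X(n))\subseteq S$ be its saturated homogeneous ideal; $X$ is called arithmetically Cohen–Macaulay (ACM) if the ring $S/I_X$ is Cohen–Macaulay. For $f:\mathbb Z\to\mathbb Z$ put $\partial f(n)=f(n)-f(n-1)$ and, if $f(n)=0$ for $n\ll 0$, $f^\sharp(n)=\sum_{m\le n}f(m)$. The postulation character of $X$, of dimension $M$, is $$\gamma_X(n)=\partial^{M+2}\bigl(h^0\mathcal I_X(n)-h^0\mathcal O_{\mathbb P^N}(n)\bigr)\qquad(n\in\mathbb Z).$$ **Proposition 3.2.** Let $X\subseteq Y\subseteq\mathbb P^N$ be closed subschemes, both ACM, with $X$ nonempty of codimension $3$ (that is, $\dim X=N-3\ge 0$) and $Y$ of codimension $2$ ($\dim Y=N-2$). Then $\gamma_X(n)-\gamma_Y^\sharp(n)\ge 0$ for all $n\in\mathbb Z$. More precisely,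 let $I_{X/Y}=I_X/I_Y\subseteq S/I_Y$. There are linearly independent linear forms $\ell_0,\dots,\ell_{N-2}\in S$ such that the polynomial ring $S'=k[\ell_0,\dots,\ell_{N-2}]\subseteq S$ is a Noether normalization of $S/I_Y$, i.e. the map $S'\to S/I_Y$ is injective and finite. For every such choice of linear forms, $I_{X/Y}$ is a graded free $S'$-module of finite rank, $$I_{X/Y}\simeq\bigoplus_{n\in\mathbb Z}S'(-n)^{L(n)},\qquad L:\mathbb Z\to\mathbb N,$$ and $\gamma_X(n)-\gamma_Y^\sharp(n)=L(n)$ for all $n\in\mathbb Z$. -/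

import Mathlib

open AlgebraicGeometry MvPolynomial

universe u

attribute [local instance] MvPolynomial.gradedAlgebra

noncomputable section

/-! ### Functions on the integers -/

/-- The first difference `∂f(n) = f(n) - f(n-1)`. -/
def firstDiff (f : ℤ → ℤ) : ℤ → ℤ := fun n => f n - f (n - 1)

/-- The primitive `f^♯(n) = ∑_{k ≤ n} f(k)`, meant for functions which vanish for `n ≪ 0`
(the sum then has finitely many nonzero terms). -/
def primitive (f : ℤ → ℤ) : ℤ → ℤ := fun n => ∑ᶠ k ∈ Set.Iic n, f k

/-! ### Cohen-Macaulay rings -/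

/-- A Noetherian ring is Cohen-Macaulay if for every maximal ideal `m` the local ring `R_m` has
depth equal to its Krull dimension, i.e. its maximal ideal contains a regular sequence of length
`dim R_m`. -/
def IsCohenMacaulayRing (R : Type u) [CommRing R] : Prop :=
  IsNoetherianRing R ∧
    ∀ (m : Ideal R) [m.IsMaximal], ∃ rs : List (Localization.AtPrime m),
      (∀ r ∈ rs, r ∈ IsLocalRing.maximalIdeal (Localization.AtPrime m)) ∧
      RingTheory.Sequence.IsRegular (Localization.AtPrime m) rs ∧
      (rs.length : WithBot ℕ∞) = ringKrullDim (Localization.AtPrime m)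

/-! ### Projective space and its closed subschemes -/

/-- The polynomial ring `S = k[X_0, …, X_N]`. -/
abbrev CoordRing (k : Type u) [Field k] (N : ℕ) : Type u := MvPolynomial (Fin (N + 1)) k

/-- The projective space `ℙ^N` over `k`, as the scheme `Proj k[X_0, …, X_N]`. -/
abbrev ProjSpace (k : Type u) [Field k] (N : ℕ) : Scheme.{u} :=
  Proj (homogeneousSubmodule (Fin (N + 1)) k)

/-- A closed subscheme `X` of `ℙ^N`, given by its (quasi-coherent) ideal sheaf `𝓘_X`. The scheme
itself is `X.subscheme`, with closed immersion `X.subschemeι : X.subscheme ⟶ ℙ^N`. -/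
abbrev ClosedSubscheme (k : Type u) [Field k] (N : ℕ) : Type u :=
  Scheme.IdealSheafData (ProjSpace k N)

namespace ClosedSubscheme

variable {k : Type u} [Field k] {N : ℕ}

lemma X_mem (i : Fin (N + 1)) :
    (X i : CoordRing k N) ∈ homogeneousSubmodule (Fin (N + 1)) k 1 :=
  isHomogeneous_X k i

/-- The standard affine open `D₊(X_i)` of `ℙ^N`. -/
def chart (k : Type u) [Field k] (N : ℕ) (i : Fin (N + 1)) : (ProjSpace k N).affineOpens :=
  ⟨Proj.basicOpen (homogeneousSubmodule (Fin (N + 1)) k) (X i),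
    Proj.isAffineOpen_basicOpen _ (X i) (X_mem i) one_pos⟩

/-- The canonical isomorphism `S_{(X_i)} ≃ Γ(D₊(X_i), 𝓞)`, where `S_{(X_i)}` is the ring of fractions
`a / X_i^m` of degree `0`. -/
def chartHom (k : Type u) [Field k] (N : ℕ) (i : Fin (N + 1)) :
    HomogeneousLocalization.Away (homogeneousSubmodule (Fin (N + 1)) k) (X i : CoordRing k N) →+*
      Γ(ProjSpace k N, (chart k N i).1) :=
  (Proj.basicOpenIsoAway (homogeneousSubmodule (Fin (N + 1)) k) (X i) (X_mem i) one_pos).hom.hom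

/-- The ideal `Γ(D₊(X_i), 𝓘)` of an ideal sheaf `𝓘` on `ℙ^N`, seen as an ideal of `S_{(X_i)}`. -/
def chartIdeal (I : ClosedSubscheme k N) (i : Fin (N + 1)) :
    Ideal (HomogeneousLocalization.Away (homogeneousSubmodule (Fin (N + 1)) k)
      (X i : CoordRing k N)) :=
  (I.ideal (chart k N i)).comap (chartHom k N i)

/-- The space of global sections `H⁰(ℙ^N, 𝓘(n))` of the twist by `n ∈ ℤ` of an ideal sheaf `𝓘`.
As usual `𝓞(n)` is the subsheaf of the constant sheaf `Frac S` given on `D₊(X_i)` by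
`X_i^n · S_{(X_i)}`, so that the sections of `𝓘(n)` on `D₊(X_i)` are the elements of
`X_i^n · Γ(D₊(X_i), 𝓘)`, and a global section is an element of `Frac S` that lies in this
submodule for every `i`. -/
def twistedSections (I : ClosedSubscheme k N) (n : ℤ) :
    Submodule k (FractionRing (CoordRing k N)) where
  carrier := {g | ∀ i : Fin (N + 1), ∃ (m : ℕ) (a : CoordRing k N)
    (ha : a ∈ homogeneousSubmodule (Fin (N + 1)) k (m • 1)),
    HomogeneousLocalization.Away.mk _ (X_mem i) m a ha ∈ chartIdeal I i ∧
    g = algebraMap (CoordRing k N) (FractionRing (CoordRing k N)) (X i) ^ n *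
      (algebraMap (CoordRing k N) (FractionRing (CoordRing k N)) a /
        algebraMap (CoordRing k N) (FractionRing (CoordRing k N)) (X i) ^ m)}
  zero_mem' := by
    intro i
    refine ⟨0, 0, Submodule.zero_mem _, ?_, by simp⟩
    convert Ideal.zero_mem _
    apply HomogeneousLocalization.val_injective
    simp [HomogeneousLocalization.Away.val_mk, Localization.mk_zero]
  add_mem' := by
    intro g g' hg hg' i
    obtain ⟨m, a, ha, hI, rfl⟩ := hg i
    obtain ⟨m', a', ha', hI', h'⟩ := hg' i
    have hX : algebraMap (CoordRing k N) (FractionRing (CoordRing k N)) (X i) ≠ 0 := by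
      simp [X_ne_zero]
    have hmem : X i ^ m' * a + X i ^ m * a' ∈
        homogeneousSubmodule (Fin (N + 1)) k ((m + m') • 1) := by
      refine Submodule.add_mem _ ?_ ?_
      · have := ((X_mem (k := k) i).pow m').mul ha
        convert this using 1
        simp [add_comm]
      · have := ((X_mem (k := k) i).pow m).mul ha'
        convert this using 1
        simp
    refine ⟨m + m', X i ^ m' * a + X i ^ m * a', hmem, ?_, ?_⟩
    · convert Ideal.add_mem _ hI hI'
      apply HomogeneousLocalization.val_injective
      simp only [HomogeneousLocalization.val_add, HomogeneousLocalization.Away.val_mk,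
        Localization.add_mk]
      congr 1
      · simp only [add_comm]
      · ext; simp [pow_add]
    · rw [h']
      simp only [map_add, map_mul, map_pow]
      field_simp
      ring
  smul_mem' := by
    intro c g hg i
    obtain ⟨m, a, ha, hI, rfl⟩ := hg i
    refine ⟨m, c • a, Submodule.smul_mem _ c ha, ?_, ?_⟩
    · convert Ideal.mul_mem_left _ (HomogeneousLocalization.Away.mk
        (homogeneousSubmodule (Fin (N + 1)) k) (X_mem i) 0 (C c) (by
          simp)) hI
      apply HomogeneousLocalization.val_injective
      simp [HomogeneousLocalization.Away.val_mk, Localization.mk_mul, smul_eq_C_mul]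
    · rw [Algebra.smul_def, smul_eq_C_mul, map_mul,
        IsScalarTower.algebraMap_apply k (CoordRing k N) (FractionRing (CoordRing k N)),
        algebraMap_eq]
      ring

/-- `h⁰ 𝓘(n)`, the dimension of `H⁰(ℙ^N, 𝓘(n))`. -/
def h0 (I : ClosedSubscheme k N) (n : ℤ) : ℤ := (Module.finrank k (twistedSections I n) : ℤ)

/-- `h⁰ 𝓞_ℙ(n)`; the structure sheaf `𝓞_ℙ` is the unit ideal sheaf. -/
def h0Proj (k : Type u) [Field k] (N : ℕ) (n : ℤ) : ℤ := h0 (⊤ : ClosedSubscheme k N) n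

/-- The dimension of a nonempty closed subscheme `X` of `ℙ^N`, as a natural number. -/
def dim (X : ClosedSubscheme k N) : ℕ := ((topologicalKrullDim X.subscheme).unbotD 0).toNat

/-- `X` is nonempty and has codimension `c` in `ℙ^N`, i.e. `dim X + c = N` (the empty subscheme
has dimension `⊥`). -/
def HasCodim (X : ClosedSubscheme k N) (c : ℕ) : Prop :=
  topologicalKrullDim X.subscheme + (c : WithBot ℕ∞) = (N : WithBot ℕ∞)

/-- The postulation character `γ_X = ∂^{M+2}(h⁰ 𝓘_X(n) - h⁰ 𝓞_ℙ(n))` with `M = dim X`. -/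
def postulationChar (X : ClosedSubscheme k N) : ℤ → ℤ :=
  firstDiff^[X.dim + 2] (fun n => h0 X n - h0Proj k N n)

/-- The saturated homogeneous ideal `I_X = ⨁_n H⁰(ℙ^N, 𝓘_X(n))` of `X` in `S`: the ideal generated
by the forms of degree `n` that are sections of `𝓘_X(n)`, for all `n`. -/
def satIdeal (X : ClosedSubscheme k N) : Ideal (CoordRing k N) :=
  Ideal.span {f | ∃ n : ℕ, f ∈ homogeneousSubmodule (Fin (N + 1)) k n ∧
    algebraMap (CoordRing k N) (FractionRing (CoordRing k N)) f ∈ twistedSections X (n : ℤ)}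

/-- `X` is arithmetically Cohen-Macaulay: the graded ring `S / I_X` is Cohen-Macaulay. -/
def IsACM (X : ClosedSubscheme k N) : Prop := IsCohenMacaulayRing (CoordRing k N ⧸ X.satIdeal)

/-- `I_{X/Y}`, the image of `I_X` in `S / I_Y` (for `X ⊆ Y` it is `I_X / I_Y`). -/
def relIdeal (X Y : ClosedSubscheme k N) : Ideal (CoordRing k N ⧸ Y.satIdeal) :=
  X.satIdeal.map (Ideal.Quotient.mk Y.satIdeal)

/-- The subring `S' = k[ℓ_0, …, ℓ_{r-1}]` of `S`. -/
abbrev subringOf {r : ℕ} (l : Fin r → CoordRing k N) : Subalgebra k (CoordRing k N) :=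
  Algebra.adjoin k (Set.range l)

/-- `ℓ_0, …, ℓ_{r-1}` are linearly independent linear forms (so that `S' = k[ℓ_0, …, ℓ_{r-1}]` is a
polynomial ring in `r` variables) and `S'` is a Noether normalization of `S / I_Y`: the map
`S' → S / I_Y` is injective and finite. -/
structure IsLinearNoetherNormalization (Y : ClosedSubscheme k N) {r : ℕ}
    (l : Fin r → CoordRing k N) : Prop where
  linear : ∀ i, l i ∈ homogeneousSubmodule (Fin (N + 1)) k 1
  linearIndependent : LinearIndependent k l
  injective : Function.Injective (algebraMap (subringOf l) (CoordRing k N ⧸ Y.satIdeal))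
  finite : Module.Finite (subringOf l) (CoordRing k N ⧸ Y.satIdeal)

/-- The graded ideal `I_{X/Y}` of `S / I_Y` is graded free over `S' = k[ℓ_0, …, ℓ_{r-1}]` with
generator-degree function `L`, i.e. `I_{X/Y} ≃ ⨁_n S'(-n)^{L(n)}`: it has a finite `S'`-basis of
homogeneous elements, exactly `L n` of which have degree `n`, for every `n`. -/
def RelIdealIsFree (X Y : ClosedSubscheme k N) {r : ℕ} (l : Fin r → CoordRing k N)
    (L : ℤ → ℕ) : Prop :=
  ∃ (t : ℕ) (b : Module.Basis (Fin t) (subringOf l) (relIdeal X Y)) (d : Fin t → ℕ),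
    (∀ j, ∃ f ∈ homogeneousSubmodule (Fin (N + 1)) k (d j), f ∈ X.satIdeal ∧
      Ideal.Quotient.mk Y.satIdeal f = (b j : CoordRing k N ⧸ Y.satIdeal)) ∧
    ∀ n : ℤ, L n = Nat.card {j : Fin t // (d j : ℤ) = n}

end ClosedSubscheme

end

noncomputable section

section LocalAlgebra

open RingTheory.Sequence IsLocalRing

/-- The module `M` over a local ring has depth at least `n`. -/
def HasRegularSequence (R : Type u) [CommRing R] [IsLocalRing R] (M : Type u) [AddCommGroup M]
    [Module R M] (n : ℕ) : Prop :=
  ∃ rs : List R, rs.length = n ∧ (∀ r ∈ rs, r ∈ maximalIdeal R) ∧ IsRegular M rs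

variable {R : Type u} [CommRing R] [IsLocalRing R] [IsNoetherianRing R]

lemma HasRegularSequence.quotSMulTop {M : Type u} [AddCommGroup M] [Module R M]
    [Module.Finite R M] [Nontrivial M] {n : ℕ} (h : HasRegularSequence R M (n + 1)) {a : R}
    (ha : a ∈ maximalIdeal R) (hreg : IsSMulRegular M a) :
    HasRegularSequence R (QuotSMulTop a M) n := by
  have lt_top : ∀ (L : Type u) [AddCommGroup L] [Module R L] [Module.Finite R L] [Nontrivial L],
      maximalIdeal R • (⊤ : Submodule R L) < ⊤ := fun L _ _ _ _ =>
    lt_top_iff_ne_top.mpr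
      (Submodule.top_ne_ideal_smul_of_le_jacobson_annihilator
        (maximalIdeal_le_jacobson _)).symm
  have : Nontrivial (QuotSMulTop a M) := nontrivial_quotSMulTop_of_mem_maximalIdeal _ ha
  have h₁ := ((ModuleCat.exists_isRegular_tfae (maximalIdeal R) (n + 1) (ModuleCat.of R M)
    (lt_top M)).out 3 0).mp h
  refine ((ModuleCat.exists_isRegular_tfae (maximalIdeal R) n
    (ModuleCat.of R (QuotSMulTop a M)) (lt_top _)).out 0 3).mp ?_
  intro K hK hK' hK'' i hi
  have zero₁ := AddCommGrpCat.isZero_of_iff_subsingleton.mpr (h₁ K hK hK' hK'' i (by omega))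
  have zero₂ := AddCommGrpCat.isZero_of_iff_subsingleton.mpr
    (h₁ K hK hK' hK'' (i + 1) (by omega))
  have hreg' : IsSMulRegular (ModuleCat.of R M) a := hreg
  exact AddCommGrpCat.subsingleton_of_isZero <|
    CategoryTheory.ShortComplex.Exact.isZero_of_both_zeros
      ((CategoryTheory.Abelian.Ext.covariant_sequence_exact₃' K
        hreg'.smulShortComplex_shortExact) i (i + 1) rfl)
      (zero₁.eq_zero_of_src _) (zero₂.eq_zero_of_tgt _)

open Pointwise in
lemma le_ringKrullDim_quotient_of_isAssociatedPrime (rs : List R) :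
    ∀ (M : Type u) [AddCommGroup M] [Module R M] [Module.Finite R M],
      (∀ r ∈ rs, r ∈ maximalIdeal R) → IsRegular M rs → ∀ P : Ideal R, IsAssociatedPrime P M →
      (rs.length : WithBot ℕ∞) ≤ ringKrullDim (R ⧸ P) := by
  induction rs with
  | nil =>
    intro M _ _ _ _ _ P hP
    have := hP.isPrime
    simpa using ringKrullDim_nonneg_of_nontrivial
  | cons x rs ih =>
    intro M _ _ _ hmem hreg P hP
    have hPp := hP.isPrime
    obtain ⟨-, u, hu⟩ := isAssociatedPrime_iff.mp hP
    rw [isRegular_cons_iff] at hreg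
    obtain ⟨hx, hrs⟩ := hreg
    have hxm : x ∈ maximalIdeal R := hmem x (by simp)
    have hu0 : u ≠ 0 := by
      rintro rfl
      exact hPp.ne_top (by rw [hu]; simp)
    let T : Submodule R M := Submodule.torsionBySet R M P
    have hT : ∀ v, v ∈ T ↔ ∀ p ∈ P, p • v = 0 := fun v => by
      simp [T, Submodule.mem_torsionBySet_iff]
    have huT : u ∈ T := (hT u).2 fun p hp => by
      rw [hu, Submodule.mem_colon_singleton] at hp
      simpa using hp
    obtain ⟨v, hvT, hv⟩ : ∃ v ∈ T, v ∉ x • (⊤ : Submodule R M) := by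
      by_contra! hcon
      have hle : T ≤ maximalIdeal R • T := by
        intro v hv
        obtain ⟨w, -, rfl⟩ := (Submodule.mem_smul_pointwise_iff_exists _ _ _).1 (hcon v hv)
        refine Submodule.smul_mem_smul hxm ((hT w).2 fun p hp => ?_)
        have := (hT _).1 hv p hp
        rw [smul_comm] at this
        exact hx (by simpa using this)
      have := Submodule.eq_bot_of_le_smul_of_le_jacobson_bot (maximalIdeal R) T
        (IsNoetherian.noetherian T) hle (maximalIdeal_le_jacobson _)
      rw [this] at huT
      exact hu0 (by simpa using huT)
    have hv0 : (Submodule.Quotient.mk v : QuotSMulTop x M) ≠ 0 := by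
      rwa [Ne, Submodule.Quotient.mk_eq_zero]
    obtain ⟨Q, hQ, hQle⟩ := exists_le_isAssociatedPrime_of_isNoetherianRing R _ hv0
    have hQp := hQ.isPrime
    have hPQ : P ≤ Q := fun p hp => hQle (by
      rw [Submodule.mem_colon_singleton, Submodule.mem_bot, ← Submodule.Quotient.mk_smul,
        (hT v).1 hvT p hp, Submodule.Quotient.mk_zero])
    have hxQ : x ∈ Q := hQle (by
      rw [Submodule.mem_colon_singleton, Submodule.mem_bot, ← Submodule.Quotient.mk_smul,
        Submodule.Quotient.mk_eq_zero]
      exact Submodule.smul_mem_pointwise_smul _ _ _ trivial)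
    have hxP : x ∉ P := fun hxP => by
      rw [hu, Submodule.mem_colon_singleton, Submodule.mem_bot] at hxP
      exact hu0 (hx (by simpa using hxP))
    have h₁ := ih (QuotSMulTop x M) (fun r hr => hmem r (by simp [hr])) hrs Q hQ
    have h₂ : ringKrullDim (R ⧸ Q) + 1 ≤ ringKrullDim (R ⧸ P) := by
      refine ringKrullDim_succ_le_of_surjective (Ideal.Quotient.factor hPQ)
        (Ideal.Quotient.factor_surjective hPQ) (r := Ideal.Quotient.mk P x) ?_ ?_
      · exact mem_nonZeroDivisors_of_ne_zero (by rwa [Ne, Ideal.Quotient.eq_zero_iff_mem])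
      · simpa [Ideal.Quotient.eq_zero_iff_mem] using hxQ
    refine le_trans ?_ h₂
    simp only [List.length_cons, Nat.cast_add, Nat.cast_one]
    gcongr

lemma ringKrullDim_quotient_le_length {P : Ideal R} [P.IsPrime] {ys : List R}
    (h : maximalIdeal R ≤ (P ⊔ Ideal.ofList ys).radical) (hys : ∀ y ∈ ys, y ∈ maximalIdeal R) :
    ringKrullDim (R ⧸ P) ≤ ys.length := by
  classical
  have hloc : IsLocalRing (R ⧸ P) :=
    IsLocalRing.of_surjective' (Ideal.Quotient.mk P) Ideal.Quotient.mk_surjective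
  rw [← maximalIdeal_height_eq_ringKrullDim]
  let s : Finset (R ⧸ P) := (ys.map (Ideal.Quotient.mk P)).toFinset
  have hmap : (maximalIdeal (R ⧸ P)).comap (Ideal.Quotient.mk P) = maximalIdeal R :=
    IsLocalRing.eq_maximalIdeal
      (Ideal.comap_isMaximal_of_surjective _ Ideal.Quotient.mk_surjective)
  have hmin : maximalIdeal (R ⧸ P) ∈ (Ideal.span (s : Set (R ⧸ P))).minimalPrimes := by
    refine ⟨⟨inferInstance, ?_⟩, ?_⟩
    · rw [Ideal.span_le]
      intro y hy
      simp only [s, List.coe_toFinset, List.mem_map, Set.mem_ofPred_eq] at hy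
      obtain ⟨z, hz, rfl⟩ := hy
      have := hys z hz
      rwa [← hmap] at this
    · rintro Q ⟨hQ, hQle⟩ -
      intro z hz
      obtain ⟨z, rfl⟩ := Ideal.Quotient.mk_surjective z
      have hz' : z ∈ maximalIdeal R := by rw [← hmap]; exact hz
      have : P ⊔ Ideal.ofList ys ≤ Q.comap (Ideal.Quotient.mk P) := by
        refine sup_le ?_ ?_
        · intro p hp
          rw [Ideal.mem_comap, Ideal.Quotient.eq_zero_iff_mem.2 hp]
          exact Q.zero_mem
        · rw [Ideal.ofList, Ideal.span_le]
          intro y hy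
          refine hQle (Ideal.subset_span ?_)
          simp only [s, List.coe_toFinset, List.mem_map, Set.mem_ofPred_eq]
          exact ⟨y, hy, rfl⟩
      have hprime : (Q.comap (Ideal.Quotient.mk P)).IsPrime := Ideal.comap_isPrime _ _
      exact (hprime.radical_le_iff.2 this) (h hz')
  have hle := Ideal.height_le_card_of_mem_minimalPrimes_span_finset hmin
  have hcard : s.card ≤ ys.length := (List.toFinset_card_le _).trans (by simp)
  exact_mod_cast hle.trans (by exact_mod_cast hcard)

open Pointwise in
/-- A system of parameters of a Cohen-Macaulay module is a weakly regular sequence. -/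
lemma isWeaklyRegular_of_hasRegularSequence (ys : List R) :
    ∀ (M : Type u) [AddCommGroup M] [Module R M] [Module.Finite R M],
      HasRegularSequence R M ys.length → (∀ y ∈ ys, y ∈ maximalIdeal R) →
      maximalIdeal R ≤ (Module.annihilator R M ⊔ Ideal.ofList ys).radical →
      IsWeaklyRegular M ys := by
  induction ys with
  | nil => intros; exact IsWeaklyRegular.nil R _
  | cons y ys ih =>
    intro M _ _ _ hreg hys hrad
    have hnt : Nontrivial M := by
      obtain ⟨rs, -, -, h⟩ := hreg
      exact h.nontrivial
    have hy : y ∈ maximalIdeal R := hys y (by simp)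
    have hyreg : IsSMulRegular M y := by
      by_contra hcon
      have : y ∈ ({r : R | IsSMulRegular M r}ᶜ : Set R) := hcon
      rw [← biUnion_associatedPrimes_eq_compl_regular] at this
      simp only [Set.mem_iUnion, SetLike.mem_coe, exists_prop] at this
      obtain ⟨P, hP, hyP⟩ := this
      have hPp : P.IsPrime := IsAssociatedPrime.isPrime hP
      obtain ⟨rs, hlen, hmem, hrs⟩ := hreg
      have h₁ := le_ringKrullDim_quotient_of_isAssociatedPrime rs M hmem hrs P hP
      have hann : Module.annihilator R M ≤ P := by
        obtain ⟨-, u, hu⟩ := isAssociatedPrime_iff.mp hP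
        intro r hr
        rw [hu, Submodule.mem_colon_singleton, Submodule.mem_bot]
        exact Module.mem_annihilator.1 hr u
      have h₂ : ringKrullDim (R ⧸ P) ≤ ys.length := by
        refine ringKrullDim_quotient_le_length (hrad.trans (Ideal.radical_mono ?_))
          fun z hz => hys z (by simp [hz])
        rw [Ideal.ofList_cons]
        refine sup_le (hann.trans le_sup_left) (sup_le ?_ le_sup_right)
        exact ((Ideal.span_singleton_le_iff_mem P).2 hyP).trans le_sup_left
      have := h₁.trans h₂
      rw [hlen] at this
      have : (ys.length + 1 : ℕ) ≤ ys.length := by exact_mod_cast this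
      omega
    refine IsWeaklyRegular.cons hyreg (ih _ (hreg.quotSMulTop hy hyreg)
      (fun z hz => hys z (by simp [hz])) (hrad.trans (Ideal.radical_mono ?_)))
    rw [Ideal.ofList_cons]
    refine sup_le (le_sup_of_le_left ?_) (sup_le (le_sup_of_le_left ?_) le_sup_right)
    · intro r hr
      rw [Module.mem_annihilator] at hr ⊢
      intro m
      obtain ⟨m, rfl⟩ := Submodule.Quotient.mk_surjective _ m
      rw [← Submodule.Quotient.mk_smul, hr, Submodule.Quotient.mk_zero]
    · rw [Ideal.span_singleton_le_iff_mem, Module.mem_annihilator]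
      intro m
      obtain ⟨m, rfl⟩ := Submodule.Quotient.mk_surjective _ m
      rw [← Submodule.Quotient.mk_smul, Submodule.Quotient.mk_eq_zero]
      exact Submodule.smul_mem_pointwise_smul _ _ _ trivial

end LocalAlgebra

section HomogeneousIdeals

variable {σ : Type*} {k : Type*} [Field k]

lemma coe_decompose_eq_homogeneousComponent (f : MvPolynomial σ k) (n : ℕ) :
    (DirectSum.decompose (homogeneousSubmodule σ k) f n : MvPolynomial σ k) =
      homogeneousComponent n f :=
  decomposition.decompose'_apply f n

lemma isHomogeneous_ideal_iff {I : Ideal (MvPolynomial σ k)} :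
    I.IsHomogeneous (homogeneousSubmodule σ k) ↔
      ∀ f ∈ I, ∀ n, homogeneousComponent n f ∈ I := by
  constructor
  · intro h f hf n
    rw [← coe_decompose_eq_homogeneousComponent]
    exact h n hf
  · intro h n f hf
    have := h f hf n
    rwa [← coe_decompose_eq_homogeneousComponent] at this

lemma homogeneousComponent_mul_right {g : MvPolynomial σ k} {d : ℕ}
    (hg : g ∈ homogeneousSubmodule σ k d) (f : MvPolynomial σ k) (n : ℕ) :
    homogeneousComponent n (f * g) =
      (if d ≤ n then homogeneousComponent (n - d) f else 0) * g := by
  have := DirectSum.coe_decompose_mul_of_right_mem (a := f) (homogeneousSubmodule σ k) n hg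
  simp only [coe_decompose_eq_homogeneousComponent] at this
  rw [this]
  split_ifs <;> simp

lemma homogeneousComponent_succ_mul {y : MvPolynomial σ k}
    (hy : y ∈ homogeneousSubmodule σ k 1) (f : MvPolynomial σ k) (n : ℕ) :
    homogeneousComponent (n + 1) (y * f) = y * homogeneousComponent n f := by
  rw [mul_comm, homogeneousComponent_mul_right hy, if_pos (by omega), mul_comm,
    Nat.add_sub_cancel]

lemma homogeneousComponent_zero_mul {y : MvPolynomial σ k}
    (hy : y ∈ homogeneousSubmodule σ k 1) (f : MvPolynomial σ k) :
    homogeneousComponent 0 (y * f) = 0 := by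
  rw [mul_comm, homogeneousComponent_mul_right hy, if_neg (by omega), zero_mul]

lemma homogeneousComponent_self {f : MvPolynomial σ k} {n : ℕ}
    (hf : f ∈ homogeneousSubmodule σ k n) : homogeneousComponent n f = f := by
  rw [homogeneousComponent_of_mem hf, if_pos rfl]

lemma isHomogeneous_span_singleton {y : MvPolynomial σ k} {d : ℕ}
    (hy : y ∈ homogeneousSubmodule σ k d) :
    (Ideal.span {y}).IsHomogeneous (homogeneousSubmodule σ k) :=
  Ideal.homogeneous_span _ _ (by rintro x rfl; exact ⟨d, hy⟩)

lemma isHomogeneous_ofList {ys : List (MvPolynomial σ k)}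
    (hys : ∀ y ∈ ys, y ∈ homogeneousSubmodule σ k 1) :
    (Ideal.ofList ys).IsHomogeneous (homogeneousSubmodule σ k) :=
  Ideal.homogeneous_span _ _ fun y hy => ⟨1, hys y hy⟩

lemma isHomogeneous_idealOfVars :
    (idealOfVars σ k).IsHomogeneous (homogeneousSubmodule σ k) :=
  Ideal.homogeneous_span _ _ (by rintro x ⟨i, rfl⟩; exact ⟨1, isHomogeneous_X k i⟩)

lemma mem_idealOfVars_iff {f : MvPolynomial σ k} : f ∈ idealOfVars σ k ↔ coeff 0 f = 0 := by
  rw [← pow_one (idealOfVars σ k), mem_pow_idealOfVars_iff']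
  constructor
  · intro h
    exact h 0 (by simp)
  · intro h x hx
    have : x = 0 := by simpa [Finsupp.degree_eq_zero_iff] using hx
    rwa [this]

lemma mem_pow_idealOfVars_of_mem {f : MvPolynomial σ k} {m n : ℕ} (hmn : m ≤ n)
    (hf : f ∈ homogeneousSubmodule σ k n) : f ∈ idealOfVars σ k ^ m := by
  rw [mem_pow_idealOfVars_iff]
  intro x hx
  rw [mem_support_iff] at hx
  by_contra hcon
  exact hx (IsHomogeneous.coeff_eq_zero hf (by omega))

lemma mem_idealOfVars_of_mem {f : MvPolynomial σ k} (hf : f ∈ homogeneousSubmodule σ k 1) :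
    f ∈ idealOfVars σ k := by
  simpa using mem_pow_idealOfVars_of_mem le_rfl hf

lemma isMaximal_idealOfVars : (idealOfVars σ k).IsMaximal := by
  have : idealOfVars σ k = RingHom.ker (constantCoeff (σ := σ) (R := k)) := by
    ext f
    rw [mem_idealOfVars_iff, RingHom.mem_ker, constantCoeff_eq]
  rw [this]
  exact RingHom.ker_isMaximal_of_surjective _ fun c => ⟨C c, by simp⟩

lemma le_idealOfVars {I : Ideal (MvPolynomial σ k)}
    (hI : I.IsHomogeneous (homogeneousSubmodule σ k)) (hne : I ≠ ⊤) : I ≤ idealOfVars σ k := by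
  intro f hf
  rw [mem_idealOfVars_iff]
  by_contra hcon
  have := isHomogeneous_ideal_iff.1 hI f hf 0
  rw [homogeneousComponent_zero] at this
  exact hne (Ideal.eq_top_of_isUnit_mem _ this ((isUnit_iff_ne_zero.2 hcon).map C))

/-- A polynomial with nonzero constant term is a nonzerodivisor modulo a homogeneous ideal. -/
lemma mem_of_mul_mem_of_coeff_ne_zero {I : Ideal (MvPolynomial σ k)}
    (hI : I.IsHomogeneous (homogeneousSubmodule σ k)) {c f : MvPolynomial σ k}
    (hc : coeff 0 c ≠ 0) (h : c * f ∈ I) : f ∈ I := by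
  set u : MvPolynomial σ k := 1 - C (coeff 0 c)⁻¹ * c with hu
  have hum : u ∈ idealOfVars σ k := by
    rw [mem_idealOfVars_iff, hu, coeff_sub, coeff_C_mul, inv_mul_cancel₀ hc]
    simp
  have h₁ : f - u * f ∈ I := by
    have : f - u * f = C (coeff 0 c)⁻¹ * (c * f) := by rw [hu]; ring
    rw [this]
    exact I.mul_mem_left _ h
  have h₂ : ∀ m, f - u ^ m * f ∈ I := by
    intro m
    induction m with
    | zero => simp
    | succ m ih =>
      have : f - u ^ (m + 1) * f = (f - u * f) + u * (f - u ^ m * f) := by ring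
      rw [this]
      exact I.add_mem h₁ (I.mul_mem_left _ ih)
  have key : ∀ n, homogeneousComponent n f ∈ I := by
    intro n
    have h₃ := isHomogeneous_ideal_iff.1 hI _ (h₂ (n + 1)) n
    have h₄ : homogeneousComponent n (u ^ (n + 1) * f) = 0 := by
      have hmem : u ^ (n + 1) * f ∈ idealOfVars σ k ^ (n + 1) :=
        Ideal.mul_mem_right _ _ (Ideal.pow_mem_pow hum _)
      rw [mem_pow_idealOfVars_iff'] at hmem
      ext x
      rw [coeff_homogeneousComponent, coeff_zero]
      split_ifs with hx
      · exact hmem x (by omega)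
      · rfl
    rwa [map_sub, h₄, sub_zero] at h₃
  rw [← sum_homogeneousComponent f]
  exact I.sum_mem fun i _ => key i

end HomogeneousIdeals

section RegularOn

/-- The sequence `ys` is regular on the module `J / K`, for ideals `K ≤ J`. -/
def RegularOn {A : Type*} [CommRing A] (J : Ideal A) : Ideal A → List A → Prop
  | _, [] => True
  | K, y :: ys => (∀ f ∈ J, y * f ∈ K → f ∈ K) ∧ RegularOn J (K ⊔ Ideal.span {y} * J) ys

lemma RegularOn.of_sup {A : Type*} [CommRing A] {J : Ideal A} (z : A) (ys : List A) :
    ∀ K : Ideal A, RegularOn ⊤ (J ⊔ K) ys → RegularOn ⊤ K (ys ++ [z]) →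
      RegularOn J (K ⊓ J) (ys ++ [z]) := by
  induction ys with
  | nil =>
    intro K _ h
    exact ⟨fun f hf hzf => ⟨h.1 f trivial hzf.1, hf⟩, trivial⟩
  | cons y ys ih =>
    intro K h₁ h₂
    refine ⟨fun f hf hyf => ⟨h₂.1 f trivial hyf.1, hf⟩, ?_⟩
    have h := ih (K ⊔ Ideal.span {y} * ⊤) (by simpa only [sup_assoc] using h₁.2) h₂.2
    suffices hK : (K ⊓ J) ⊔ Ideal.span {y} * J = (K ⊔ Ideal.span {y} * ⊤) ⊓ J by
      rw [hK]
      exact h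
    apply le_antisymm
    · refine sup_le (inf_le_inf_right _ le_sup_left) (le_inf ?_ Ideal.mul_le_right)
      exact (Ideal.mul_mono_right le_top).trans le_sup_right
    · rintro f ⟨hf, hfJ⟩
      obtain ⟨κ, hκ, v, hv, rfl⟩ := Submodule.mem_sup.1 hf
      obtain ⟨g, -, rfl⟩ := Ideal.mem_span_singleton_mul.1 hv
      have hg : g ∈ J ⊔ K := h₁.1 g trivial (by
        have : y * g = (κ + y * g) - κ := by ring
        rw [this]
        exact Ideal.sub_mem _ (Ideal.mem_sup_left hfJ) (Ideal.mem_sup_right hκ))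
      obtain ⟨x, hx, κ', hκ', rfl⟩ := Submodule.mem_sup.1 hg
      have e : κ + y * (x + κ') = (κ + y * κ') + y * x := by ring
      rw [e] at hfJ ⊢
      refine Ideal.add_mem _ (Ideal.mem_sup_left ⟨?_, ?_⟩) (Ideal.mem_sup_right ?_)
      · exact K.add_mem hκ (K.mul_mem_left _ hκ')
      · exact (J.add_mem_iff_left (J.mul_mem_left _ hx)).1 hfJ
      · exact Ideal.mem_span_singleton_mul.2 ⟨x, hx, rfl⟩

end RegularOn

section GradedFree

variable {σ : Type*} {k : Type*} [Field k]

/-- The degree `n` part of a homogeneous ideal. -/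
def gradedPiece (J : Ideal (MvPolynomial σ k)) (n : ℕ) : Submodule k (MvPolynomial σ k) :=
  J.restrictScalars k ⊓ homogeneousSubmodule σ k n

instance [Finite σ] (J : Ideal (MvPolynomial σ k)) (n : ℕ) :
    FiniteDimensional k (gradedPiece J n) := by
  have : FiniteDimensional k (homogeneousSubmodule σ k n) :=
    Module.Finite.iff_fg.2 (homogeneousSubmodule_fg σ k n)
  exact Submodule.finiteDimensional_of_le inf_le_right

/-- The Hilbert function of a homogeneous ideal, extended by zero to negative degrees. -/
def hilbertFun (J : Ideal (MvPolynomial σ k)) (n : ℤ) : ℤ :=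
  if 0 ≤ n then (Module.finrank k (gradedPiece J n.toNat) : ℤ) else 0

lemma hilbertFun_natCast (J : Ideal (MvPolynomial σ k)) (n : ℕ) :
    hilbertFun J n = Module.finrank k (gradedPiece J n) := by
  simp [hilbertFun]

lemma hilbertFun_of_neg (J : Ideal (MvPolynomial σ k)) {n : ℤ} (hn : n < 0) :
    hilbertFun J n = 0 := by
  simp [hilbertFun, hn]

lemma firstDiff_hilbertFun_sub [Finite σ] {J K : Ideal (MvPolynomial σ k)} (hKJ : K ≤ J)
    (hJ : J.IsHomogeneous (homogeneousSubmodule σ k))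
    (hK : K.IsHomogeneous (homogeneousSubmodule σ k)) {y : MvPolynomial σ k}
    (hy : y ∈ homogeneousSubmodule σ k 1) (hreg : ∀ f ∈ J, y * f ∈ K → f ∈ K) :
    firstDiff (fun n => hilbertFun J n - hilbertFun K n) =
      fun n => hilbertFun J n - hilbertFun (K ⊔ Ideal.span {y} * J) n := by
  by_cases hy0 : y = 0
  · subst hy0
    have : K = J := le_antisymm hKJ fun f hf => hreg f hf (by simp)
    subst this
    funext n
    simp [firstDiff]
  funext n
  rw [firstDiff]
  obtain hn | ⟨m, rfl⟩ | rfl : n < 0 ∨ (∃ m : ℕ, n = m + 1) ∨ n = 0 := by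
    rcases lt_trichotomy n 0 with h | h | h
    · exact Or.inl h
    · exact Or.inr (Or.inr h)
    · exact Or.inr (Or.inl ⟨(n - 1).toNat, by omega⟩)
  · simp [hilbertFun_of_neg, hn, show n - 1 < 0 by omega]
  · rw [add_sub_cancel_right]
    have hcast : ((m : ℤ) + 1) = ((m + 1 : ℕ) : ℤ) := by push_cast; ring
    rw [hcast]
    simp only [hilbertFun_natCast]
    let φ : MvPolynomial σ k →ₗ[k] MvPolynomial σ k := LinearMap.mulLeft k y
    have hφ : Function.Injective φ := fun a b hab => mul_left_cancel₀ hy0 hab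
    have hfin : ∀ J : Ideal (MvPolynomial σ k), Module.finrank k ((gradedPiece J m).map φ) =
        Module.finrank k (gradedPiece J m) := fun J =>
      ((gradedPiece J m).equivMapOfInjective φ hφ).symm.finrank_eq
    have hsup : gradedPiece (K ⊔ Ideal.span {y} * J) (m + 1) =
        gradedPiece K (m + 1) ⊔ (gradedPiece J m).map φ := by
      apply le_antisymm
      · rintro f ⟨hf, hfm⟩
        obtain ⟨κ, hκ, v, hv, rfl⟩ := Submodule.mem_sup.1 hf
        obtain ⟨g, hg, rfl⟩ := Ideal.mem_span_singleton_mul.1 hv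
        rw [← homogeneousComponent_self hfm, map_add, homogeneousComponent_succ_mul hy]
        refine Submodule.add_mem_sup ⟨isHomogeneous_ideal_iff.1 hK _ hκ _,
          homogeneousComponent_isHomogeneous _ _⟩ ⟨_, ⟨isHomogeneous_ideal_iff.1 hJ _ hg _,
          homogeneousComponent_isHomogeneous _ _⟩, rfl⟩
      · refine sup_le ?_ ?_
        · rintro f ⟨hf, hfm⟩
          exact ⟨Ideal.mem_sup_left hf, hfm⟩
        · rintro _ ⟨f, ⟨hf, hfm⟩, rfl⟩
          refine ⟨Ideal.mem_sup_right (Ideal.mem_span_singleton_mul.2 ⟨f, hf, rfl⟩), ?_⟩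
          rw [add_comm m 1]
          exact IsHomogeneous.mul hy hfm
    have hinf : gradedPiece K (m + 1) ⊓ (gradedPiece J m).map φ = (gradedPiece K m).map φ := by
      apply le_antisymm
      · rintro _ ⟨⟨hf, -⟩, f, ⟨hfJ, hfm⟩, rfl⟩
        exact ⟨f, ⟨hreg f hfJ hf, hfm⟩, rfl⟩
      · rintro _ ⟨f, ⟨hf, hfm⟩, rfl⟩
        refine ⟨⟨K.mul_mem_left _ hf, ?_⟩, f, ⟨hKJ hf, hfm⟩, rfl⟩
        rw [add_comm m 1]
        exact IsHomogeneous.mul hy hfm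
    have := Submodule.finrank_sup_add_finrank_inf_eq (gradedPiece K (m + 1))
      ((gradedPiece J m).map φ)
    rw [← hsup, hinf, hfin, hfin] at this
    omega
  · have h0 : gradedPiece (K ⊔ Ideal.span {y} * J) 0 = gradedPiece K 0 := by
      apply le_antisymm
      · rintro f ⟨hf, hfm⟩
        obtain ⟨κ, hκ, v, hv, rfl⟩ := Submodule.mem_sup.1 hf
        obtain ⟨g, hg, rfl⟩ := Ideal.mem_span_singleton_mul.1 hv
        rw [← homogeneousComponent_self hfm, map_add, homogeneousComponent_zero_mul hy, add_zero]
        exact ⟨isHomogeneous_ideal_iff.1 hK _ hκ _, homogeneousComponent_isHomogeneous _ _⟩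
      · rintro f ⟨hf, hfm⟩
        exact ⟨Ideal.mem_sup_left hf, hfm⟩
    have e : (0 : ℤ) = ((0 : ℕ) : ℤ) := rfl
    rw [hilbertFun_of_neg J (by norm_num : (0 : ℤ) - 1 < 0),
      hilbertFun_of_neg K (by norm_num : (0 : ℤ) - 1 < 0), e]
    simp only [hilbertFun_natCast]
    rw [h0, sub_self, sub_zero]

end GradedFree

section GradedFree

variable {σ : Type*} {k : Type*} [Field k]

/-- The polynomials congruent modulo `K` to a combination of the `f j` with coefficients
in `A`. -/
def combinationsMod {ι : Type*} [Fintype ι] (A : Subalgebra k (MvPolynomial σ k))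
    (K : Ideal (MvPolynomial σ k)) (f : ι → MvPolynomial σ k) :
    AddSubmonoid (MvPolynomial σ k) where
  carrier := {g | ∃ c : ι → MvPolynomial σ k, (∀ j, c j ∈ A) ∧ g - ∑ j, c j * f j ∈ K}
  zero_mem' := ⟨0, fun _ => A.zero_mem, by simp⟩
  add_mem' := by
    rintro a b ⟨c, hc, hac⟩ ⟨d, hd, hbd⟩
    refine ⟨c + d, fun j => A.add_mem (hc j) (hd j), ?_⟩
    convert K.add_mem hac hbd using 1
    simp only [Pi.add_apply, add_mul, Finset.sum_add_distrib]
    ring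

/-- The homogeneous elements `f j ∈ J` of degree `d j` form a basis of `J / K` over the algebra
generated by the linear forms `ys`, and they determine its Hilbert function. -/
structure IsGradedBasis (ys : List (MvPolynomial σ k)) (J K : Ideal (MvPolynomial σ k))
    {ι : Type} [Fintype ι] (f : ι → MvPolynomial σ k) (d : ι → ℕ) : Prop where
  mem : ∀ j, f j ∈ J
  homogeneous : ∀ j, f j ∈ homogeneousSubmodule σ k (d j)
  independent : ∀ c : ι → MvPolynomial σ k, (∀ j, c j ∈ Algebra.adjoin k {y | y ∈ ys}) →
    ∑ j, c j * f j ∈ K → ∀ j, c j = 0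
  spanning : ∀ g ∈ J, g ∈ combinationsMod (Algebra.adjoin k {y | y ∈ ys}) K f
  hilbertFun : ∀ n : ℤ, firstDiff^[ys.length] (fun n => hilbertFun J n - hilbertFun K n) n =
    Nat.card {j : ι // (d j : ℤ) = n}

lemma homogeneousComponent_mem_adjoin {s : Set (MvPolynomial σ k)}
    (hs : ∀ y ∈ s, y ∈ homogeneousSubmodule σ k 1) {c : MvPolynomial σ k}
    (hc : c ∈ Algebra.adjoin k s) (n : ℕ) : homogeneousComponent n c ∈ Algebra.adjoin k s := by
  have hmon : ∀ x ∈ Submonoid.closure s, ∃ d, x ∈ homogeneousSubmodule σ k d := by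
    intro x hx
    induction hx using Submonoid.closure_induction with
    | mem x hx => exact ⟨1, hs x hx⟩
    | one => exact ⟨0, isHomogeneous_one σ k⟩
    | mul x y _ _ hx hy =>
      obtain ⟨a, ha⟩ := hx
      obtain ⟨b, hb⟩ := hy
      exact ⟨a + b, IsHomogeneous.mul ha hb⟩
  rw [← Subalgebra.mem_toSubmodule, Algebra.adjoin_eq_span] at hc ⊢
  induction hc using Submodule.span_induction with
  | mem x hx =>
    obtain ⟨d, hd⟩ := hmon x hx
    rw [homogeneousComponent_of_mem hd]
    split_ifs
    · exact Submodule.subset_span hx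
    · exact Submodule.zero_mem _
  | zero => simp
  | add x y _ _ hx hy => rw [map_add]; exact Submodule.add_mem _ hx hy
  | smul a x _ hx => rw [map_smul]; exact Submodule.smul_mem _ _ hx

lemma exists_eq_add_mul_of_mem_adjoin_cons {y : MvPolynomial σ k} {ys : List (MvPolynomial σ k)}
    {c : MvPolynomial σ k} (hc : c ∈ Algebra.adjoin k {z | z ∈ y :: ys}) :
    ∃ c' ∈ Algebra.adjoin k {z | z ∈ ys}, ∃ q ∈ Algebra.adjoin k {z | z ∈ y :: ys},
      c = c' + y * q := by
  have hle : Algebra.adjoin k {z | z ∈ ys} ≤ Algebra.adjoin k {z | z ∈ y :: ys} :=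
    Algebra.adjoin_mono fun z hz => List.mem_cons_of_mem _ hz
  have hy : y ∈ Algebra.adjoin k {z | z ∈ y :: ys} := Algebra.subset_adjoin (by simp)
  induction hc using Algebra.adjoin_induction with
  | mem x hx =>
    rcases List.mem_cons.1 hx with rfl | hx
    · exact ⟨0, Subalgebra.zero_mem _, 1, Subalgebra.one_mem _, by simp⟩
    · exact ⟨x, Algebra.subset_adjoin hx, 0, Subalgebra.zero_mem _, by simp⟩
  | algebraMap r => exact ⟨_, Subalgebra.algebraMap_mem _ r, 0, Subalgebra.zero_mem _, by simp⟩
  | add a b _ _ ha hb =>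
    obtain ⟨a', ha', p, hp, rfl⟩ := ha
    obtain ⟨b', hb', q, hq, rfl⟩ := hb
    exact ⟨_, Subalgebra.add_mem _ ha' hb', _, Subalgebra.add_mem _ hp hq, by ring⟩
  | mul a b _ _ ha hb =>
    obtain ⟨a', ha', p, hp, rfl⟩ := ha
    obtain ⟨b', hb', q, hq, rfl⟩ := hb
    refine ⟨_, Subalgebra.mul_mem _ ha' hb', a' * q + p * (b' + y * q), ?_, by ring⟩
    exact Subalgebra.add_mem _ (Subalgebra.mul_mem _ (hle ha') hq)
      (Subalgebra.mul_mem _ hp (Subalgebra.add_mem _ (hle hb') (Subalgebra.mul_mem _ hy hq)))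

lemma IsGradedBasis.cons [Finite σ] {y : MvPolynomial σ k} {ys : List (MvPolynomial σ k)}
    {J K : Ideal (MvPolynomial σ k)} {ι : Type} [Fintype ι] {f : ι → MvPolynomial σ k}
    {d : ι → ℕ} (hKJ : K ≤ J) (hJ : J.IsHomogeneous (homogeneousSubmodule σ k))
    (hK : K.IsHomogeneous (homogeneousSubmodule σ k))
    (hys : ∀ z ∈ y :: ys, z ∈ homogeneousSubmodule σ k 1)
    (hreg : ∀ f ∈ J, y * f ∈ K → f ∈ K)
    (h : IsGradedBasis ys J (K ⊔ Ideal.span {y} * J) f d) :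
    IsGradedBasis (y :: ys) J K f d := by
  have hy : y ∈ homogeneousSubmodule σ k 1 := hys y (by simp)
  have hle : Algebra.adjoin k {z | z ∈ ys} ≤ Algebra.adjoin k {z | z ∈ y :: ys} :=
    Algebra.adjoin_mono fun z hz => List.mem_cons_of_mem _ hz
  have hyA : y ∈ Algebra.adjoin k {z | z ∈ y :: ys} := Algebra.subset_adjoin (by simp)
  refine ⟨h.mem, h.homogeneous, ?_, ?_, ?_⟩
  · have key : ∀ n, ∀ c : ι → MvPolynomial σ k,
        (∀ j, c j ∈ Algebra.adjoin k {z | z ∈ y :: ys}) → ∑ j, c j * f j ∈ K →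
        (∀ j, c j = 0 ∨ (c j).totalDegree < n) → ∀ j, c j = 0 := by
      intro n
      induction n with
      | zero => intro c _ _ hdeg j; exact (hdeg j).resolve_right (by omega)
      | succ n ih =>
        intro c hc hsum hdeg
        choose c' hc' q hq hcq using fun j => exists_eq_add_mul_of_mem_adjoin_cons (hc j)
        have hsplit : ∑ j, c j * f j = ∑ j, c' j * f j + y * ∑ j, q j * f j := by
          rw [Finset.mul_sum, ← Finset.sum_add_distrib]
          exact Finset.sum_congr rfl fun j _ => by rw [hcq j]; ring
        have hqJ : ∑ j, q j * f j ∈ J := J.sum_mem fun j _ => J.mul_mem_left _ (h.mem j)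
        have hc'0 : ∀ j, c' j = 0 := h.independent c' hc' (by
          have : ∑ j, c' j * f j = ∑ j, c j * f j + y * (-∑ j, q j * f j) := by
            rw [hsplit]; ring
          rw [this]
          exact Ideal.add_mem _ (Ideal.mem_sup_left hsum) (Ideal.mem_sup_right
            (Ideal.mem_span_singleton_mul.2 ⟨_, J.neg_mem hqJ, rfl⟩)))
        have hcq' : ∀ j, c j = y * q j := fun j => by rw [hcq j, hc'0 j, zero_add]
        by_cases hy0 : y = 0
        · intro j
          rw [hcq' j, hy0, zero_mul]
        have hqK : ∑ j, q j * f j ∈ K := hreg _ hqJ (by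
          rw [hsplit] at hsum
          simpa [hc'0] using hsum)
        have hq0 := ih q hq hqK fun j => by
          by_cases hqj : q j = 0
          · exact Or.inl hqj
          · right
            rcases hdeg j with h0 | hlt
            · rw [hcq' j] at h0
              exact absurd h0 (mul_ne_zero hy0 hqj)
            · rw [hcq' j, totalDegree_mul_of_isDomain hy0 hqj,
                IsHomogeneous.totalDegree hy hy0] at hlt
              omega
        intro j
        rw [hcq' j, hq0 j, mul_zero]
    intro c hc hsum
    refine key (∑ j, (c j).totalDegree + 1) c hc hsum fun j => Or.inr ?_
    exact Nat.lt_succ_of_le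
      (Finset.single_le_sum (f := fun j => (c j).totalDegree) (fun _ _ => Nat.zero_le _)
        (Finset.mem_univ j))
  · have step : ∀ n, ∀ g ∈ J, g ∈ homogeneousSubmodule σ k n → ∃ u ∈ J,
        g - homogeneousComponent n (y * u) ∈
          combinationsMod (Algebra.adjoin k {z | z ∈ y :: ys}) K f := by
      intro n g hg hgn
      obtain ⟨c, hc, hgc⟩ := h.spanning g hg
      obtain ⟨κ, hκ, v, hv, hκv⟩ := Submodule.mem_sup.1 hgc
      obtain ⟨u, hu, rfl⟩ := Ideal.mem_span_singleton_mul.1 hv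
      refine ⟨u, hu, fun j => if d j ≤ n then homogeneousComponent (n - d j) (c j) else 0,
        fun j => ?_, ?_⟩
      · dsimp only
        split_ifs
        · exact homogeneousComponent_mem_adjoin hys (hle (hc j)) _
        · exact Subalgebra.zero_mem _
      · have := congrArg (homogeneousComponent n) hκv
        simp only [map_add, map_sub, map_sum, homogeneousComponent_mul_right (h.homogeneous _),
          homogeneousComponent_self hgn] at this
        rw [sub_right_comm, ← this, add_sub_cancel_right]
        exact isHomogeneous_ideal_iff.1 hK _ hκ n
    have key : ∀ n, ∀ g ∈ J, g ∈ homogeneousSubmodule σ k n →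
        g ∈ combinationsMod (Algebra.adjoin k {z | z ∈ y :: ys}) K f := by
      intro n
      induction n with
      | zero =>
        intro g hg hgn
        obtain ⟨u, -, hu⟩ := step 0 g hg hgn
        rwa [homogeneousComponent_zero_mul hy, sub_zero] at hu
      | succ n ih =>
        intro g hg hgn
        obtain ⟨u, huJ, hu⟩ := step (n + 1) g hg hgn
        rw [homogeneousComponent_succ_mul hy] at hu
        obtain ⟨c, hc, huc⟩ := ih _ (isHomogeneous_ideal_iff.1 hJ u huJ n)
          (homogeneousComponent_isHomogeneous _ _)
        have hyu : y * homogeneousComponent n u ∈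
            combinationsMod (Algebra.adjoin k {z | z ∈ y :: ys}) K f := by
          refine ⟨fun j => y * c j, fun j => Subalgebra.mul_mem _ hyA (hc j), ?_⟩
          convert K.mul_mem_left y huc using 1
          rw [mul_sub, Finset.mul_sum]
          simp only [mul_assoc]
        convert AddSubmonoid.add_mem _ hu hyu using 1
        ring
    intro g hg
    rw [← sum_homogeneousComponent g]
    exact AddSubmonoid.sum_mem _ fun n _ => key n _ (isHomogeneous_ideal_iff.1 hJ g hg n)
      (homogeneousComponent_isHomogeneous _ _)
  · intro n
    rw [List.length_cons, Function.iterate_succ_apply, firstDiff_hilbertFun_sub hKJ hJ hK hy hreg]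
    exact h.hilbertFun n

lemma exists_isGradedBasis_nil [Finite σ] {J K : Ideal (MvPolynomial σ k)} (hKJ : K ≤ J)
    (hJ : J.IsHomogeneous (homogeneousSubmodule σ k))
    (hK : K.IsHomogeneous (homogeneousSubmodule σ k)) {D : ℕ}
    (hD : ∀ n ≥ D, ∀ f ∈ J, f ∈ homogeneousSubmodule σ k n → f ∈ K) :
    ∃ (ι : Type) (_ : Fintype ι) (f : ι → MvPolynomial σ k) (d : ι → ℕ),
      IsGradedBasis [] J K f d := by
  classical
  have hle : ∀ n, gradedPiece K n ≤ gradedPiece J n := fun n =>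
    inf_le_inf_right _ fun _ hf => hKJ hf
  let q : ∀ n, Submodule k (gradedPiece J n) := fun n => (gradedPiece K n).submoduleOf _
  let r : ℕ → ℕ := fun n => Module.finrank k (gradedPiece J n ⧸ q n)
  let b : ∀ n, Module.Basis (Fin (r n)) k (gradedPiece J n ⧸ q n) := fun n =>
    Module.finBasis k (gradedPiece J n ⧸ q n)
  choose g hg using fun n (i : Fin (r n)) => Submodule.Quotient.mk_surjective (q n) (b n i)
  have hmk : ∀ n (u : gradedPiece J n), (Submodule.Quotient.mk u : gradedPiece J n ⧸ q n) = 0 ↔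
      (u : MvPolynomial σ k) ∈ K := fun n u => by
    rw [Submodule.Quotient.mk_eq_zero]
    exact ⟨fun h => h.1, fun h => ⟨h, u.2.2⟩⟩
  let f : (Σ n : Fin D, Fin (r n)) → MvPolynomial σ k := fun j => (g j.1 j.2 : MvPolynomial σ k)
  have hfd : ∀ j : (Σ n : Fin D, Fin (r n)), f j ∈ homogeneousSubmodule σ k (j.1 : ℕ) :=
    fun j => (g j.1 j.2).2.2
  have hbot : Algebra.adjoin k {y : MvPolynomial σ k | y ∈ ([] : List (MvPolynomial σ k))} = ⊥ := by
    have : {y : MvPolynomial σ k | y ∈ ([] : List (MvPolynomial σ k))} = ∅ := by ext; simp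
    rw [this, Algebra.adjoin_empty]
  refine ⟨Σ n : Fin D, Fin (r n), inferInstance, f, fun j => j.1, fun j => (g j.1 j.2).2.1, hfd,
    ?_, ?_, ?_⟩
  · intro c hc hsum
    rw [hbot] at hc
    choose a ha using fun j => Algebra.mem_bot.1 (hc j)
    rintro ⟨n, i⟩
    have h₁ := isHomogeneous_ideal_iff.1 hK _ hsum n
    have h₂ : homogeneousComponent (n : ℕ) (∑ j, c j * f j) =
        ((∑ i, a ⟨n, i⟩ • g n i : gradedPiece J n) : MvPolynomial σ k) := by
      rw [map_sum, Fintype.sum_sigma, Finset.sum_eq_single n]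
      · rw [Submodule.coe_sum]
        refine Finset.sum_congr rfl fun i _ => ?_
        rw [← ha, ← Algebra.smul_def, map_smul, homogeneousComponent_self (hfd ⟨n, i⟩)]
        rfl
      · intro m _ hmn
        refine Finset.sum_eq_zero fun i _ => ?_
        rw [← ha, ← Algebra.smul_def, map_smul, homogeneousComponent_of_mem (hfd ⟨m, i⟩),
          if_neg fun h => hmn (Fin.ext h.symm), smul_zero]
      · simp
    rw [h₂, ← hmk] at h₁
    have h₃ : ∑ i, a ⟨n, i⟩ • b n i = 0 := by
      rw [← h₁, ← Submodule.mkQ_apply, map_sum]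
      refine Finset.sum_congr rfl fun i _ => ?_
      rw [map_smul, Submodule.mkQ_apply, hg]
    have h₄ := Fintype.linearIndependent_iff.1 (b n).linearIndependent _ h₃ i
    rw [← ha, h₄, map_zero]
  · have key : ∀ n, ∀ u ∈ J, u ∈ homogeneousSubmodule σ k n → u ∈ combinationsMod
        (Algebra.adjoin k {y : MvPolynomial σ k | y ∈ ([] : List (MvPolynomial σ k))}) K f := by
      intro n u hu hun
      by_cases hnD : n < D
      · let v : ∀ m, gradedPiece J m := fun m => ⟨homogeneousComponent m u,
          isHomogeneous_ideal_iff.1 hJ u hu m, homogeneousComponent_isHomogeneous _ _⟩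
        refine ⟨fun j => algebraMap k _ ((b j.1).repr (Submodule.Quotient.mk (v j.1)) j.2),
          fun j => Subalgebra.algebraMap_mem _ _, ?_⟩
        have h₁ : ∑ j, algebraMap k (MvPolynomial σ k)
            ((b j.1).repr (Submodule.Quotient.mk (v j.1)) j.2) * f j =
            ((∑ i, (b n).repr (Submodule.Quotient.mk (v n)) i • g n i : gradedPiece J n) :
              MvPolynomial σ k) := by
          rw [Fintype.sum_sigma, Finset.sum_eq_single ⟨n, hnD⟩]
          · rw [Submodule.coe_sum]
            refine Finset.sum_congr rfl fun i _ => ?_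
            rw [← Algebra.smul_def]
            rfl
          · intro m _ hmn
            have hv : v m = 0 := by
              apply Subtype.ext
              change homogeneousComponent (m : ℕ) u = 0
              rw [homogeneousComponent_of_mem hun, if_neg fun h => hmn (Fin.ext h)]
            simp [hv]
          · simp
        have h₂ : u = (v n : MvPolynomial σ k) := (homogeneousComponent_self hun).symm
        suffices h₃ : ((v n - ∑ i, (b n).repr (Submodule.Quotient.mk (v n)) i • g n i :
            gradedPiece J n) : MvPolynomial σ k) ∈ K by
          rwa [Submodule.coe_sub, ← h₂, ← h₁] at h₃
        rw [← hmk, ← Submodule.mkQ_apply, map_sub, map_sum, sub_eq_zero]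
        conv_lhs => rw [Submodule.mkQ_apply, ← (b n).sum_repr (Submodule.Quotient.mk (v n))]
        refine Finset.sum_congr rfl fun i _ => ?_
        rw [map_smul, Submodule.mkQ_apply, hg]
      · exact ⟨0, fun _ => Subalgebra.zero_mem _, by
          simpa using hD n (not_lt.1 hnD) u hu hun⟩
    intro u hu
    rw [← sum_homogeneousComponent u]
    exact AddSubmonoid.sum_mem _ fun n _ => key n _ (isHomogeneous_ideal_iff.1 hJ u hu n)
      (homogeneousComponent_isHomogeneous _ _)
  · intro n
    rw [List.length_nil, Function.iterate_zero, id_eq]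
    by_cases hn : n < 0
    · rw [hilbertFun_of_neg _ hn, hilbertFun_of_neg _ hn, sub_zero]
      have : IsEmpty {j : (Σ n : Fin D, Fin (r n)) // ((j.1 : ℕ) : ℤ) = n} :=
        ⟨fun j => by have := j.2; omega⟩
      simp
    · obtain ⟨m, rfl⟩ := Int.eq_ofNat_of_zero_le (not_lt.1 hn)
      have hr : (Module.finrank k (gradedPiece J m) : ℤ) - Module.finrank k (gradedPiece K m) =
          r m := by
        have h₁ := Submodule.finrank_quotient_add_finrank (q m)
        have h₂ : Module.finrank k (q m) = Module.finrank k (gradedPiece K m) :=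
          (Submodule.submoduleOfEquivOfLe (hle m)).finrank_eq
        simp only [r]
        omega
      rw [hilbertFun_natCast, hilbertFun_natCast, hr, Nat.card_eq_fintype_card,
        Fintype.card_subtype, Finset.card_filter, Fintype.sum_sigma]
      norm_cast
      by_cases hmD : m < D
      · rw [Finset.sum_eq_single ⟨m, hmD⟩]
        · simp
        · intro p _ hp
          refine Finset.sum_eq_zero fun i _ => if_neg fun h => hp (Fin.ext h)
        · simp
      · rw [Finset.sum_eq_zero fun p _ => Finset.sum_eq_zero fun i _ => if_neg fun h => ?_]
        · have : gradedPiece J m = gradedPiece K m := le_antisymm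
            (fun u hu => ⟨hD m (not_lt.1 hmD) u hu.1 hu.2, hu.2⟩) (hle m)
          rw [this, sub_self] at hr
          exact_mod_cast hr.symm
        · have := p.2
          omega

theorem exists_isGradedBasis [Finite σ] {J : Ideal (MvPolynomial σ k)}
    (hJ : J.IsHomogeneous (homogeneousSubmodule σ k)) (ys : List (MvPolynomial σ k)) :
    ∀ K : Ideal (MvPolynomial σ k), K ≤ J → K.IsHomogeneous (homogeneousSubmodule σ k) →
      (∀ y ∈ ys, y ∈ homogeneousSubmodule σ k 1) → RegularOn J K ys →
      (∃ D : ℕ, ∀ n ≥ D, ∀ f ∈ J, f ∈ homogeneousSubmodule σ k n →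
        f ∈ K ⊔ Ideal.ofList ys * J) →
      ∃ (ι : Type) (_ : Fintype ι) (f : ι → MvPolynomial σ k) (d : ι → ℕ),
        IsGradedBasis ys J K f d := by
  induction ys with
  | nil =>
    rintro K hKJ hK - - ⟨D, hD⟩
    exact exists_isGradedBasis_nil hKJ hJ hK (D := D) (by simpa using hD)
  | cons y ys ih =>
    rintro K hKJ hK hys hreg ⟨D, hD⟩
    obtain ⟨ι, _, f, d, h⟩ := ih (K ⊔ Ideal.span {y} * J) (sup_le hKJ Ideal.mul_le_right)
      (hK.sup ((isHomogeneous_span_singleton (hys y (by simp))).mul hJ))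
      (fun z hz => hys z (by simp [hz])) hreg.2
      ⟨D, by simpa only [Ideal.ofList_cons, Ideal.sup_mul, sup_assoc] using hD⟩
    exact ⟨ι, _, f, d, h.cons hKJ hJ hK hys hreg.1⟩

end GradedFree

section Dimension

variable {σ : Type*} {k : Type*} [Field k]

lemma irrelevant_eq_idealOfVars :
    (HomogeneousIdeal.irrelevant (homogeneousSubmodule σ k)).toIdeal = idealOfVars σ k := by
  ext f
  rw [mem_idealOfVars_iff, HomogeneousIdeal.mem_iff, HomogeneousIdeal.mem_irrelevant_iff,
    GradedRing.proj_apply, coe_decompose_eq_homogeneousComponent, homogeneousComponent_zero,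
    C_eq_zero]

/-- The points of projective space lying in the zero locus of an ideal, i.e. the relevant
homogeneous primes containing it. -/
abbrev ProjPoints (I : Ideal (MvPolynomial σ k)) : Type _ :=
  {P : ProjectiveSpectrum (homogeneousSubmodule σ k) // I ≤ P.asHomogeneousIdeal.toIdeal}

/-- The point of projective space given by a relevant homogeneous prime. -/
def ProjPoints.mk {I P : Ideal (MvPolynomial σ k)} (hP : P.IsPrime)
    (hhom : P.IsHomogeneous (homogeneousSubmodule σ k)) (hne : ¬ idealOfVars σ k ≤ P)
    (hI : I ≤ P) : ProjPoints I :=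
  ⟨⟨⟨P, hhom⟩, hP, fun h => hne (by rw [← irrelevant_eq_idealOfVars]; exact h)⟩, hI⟩

lemma ProjPoints.lt_iff {I : Ideal (MvPolynomial σ k)} {P Q : ProjPoints I} :
    P < Q ↔ P.1.asHomogeneousIdeal.toIdeal < Q.1.asHomogeneousIdeal.toIdeal := Iff.rfl

lemma ProjPoints.not_idealOfVars_le {I : Ideal (MvPolynomial σ k)} (P : ProjPoints I) :
    ¬ idealOfVars σ k ≤ P.1.asHomogeneousIdeal.toIdeal := by
  rw [← irrelevant_eq_idealOfVars]
  exact P.1.not_irrelevant_le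

lemma isHomogeneous_of_mem_minimalPrimes {I P : Ideal (MvPolynomial σ k)}
    (hI : I.IsHomogeneous (homogeneousSubmodule σ k)) (hP : P ∈ I.minimalPrimes) :
    P.IsHomogeneous (homogeneousSubmodule σ k) := by
  have hcore : I ≤ (P.homogeneousCore (homogeneousSubmodule σ k)).toIdeal := by
    rw [← hI.toIdeal_homogeneousCore_eq_self]
    exact Ideal.homogeneousCore_mono _ hP.1.2
  have := hP.2 ⟨hP.1.1.homogeneousCore, hcore⟩ (Ideal.toIdeal_homogeneousCore_le _ _)
  rw [Ideal.IsHomogeneous.iff_eq]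
  exact le_antisymm (Ideal.toIdeal_homogeneousCore_le _ _) this

/-- If the zero locus of a homogeneous ideal in projective space has dimension less than `e`, then
`e` general linear forms from a base point free linear system cut it down to the empty set. -/
theorem exists_linear_parameters [Finite σ] [Infinite k] (V : Submodule k (MvPolynomial σ k))
    (e : ℕ) : ∀ I : Ideal (MvPolynomial σ k), I.IsHomogeneous (homogeneousSubmodule σ k) →
      V ≤ homogeneousSubmodule σ k 1 →
      idealOfVars σ k ≤ (I ⊔ Ideal.span V).radical →
      (∀ p : LTSeries (ProjPoints I), p.length < e) →
      ∃ ys : List (MvPolynomial σ k), ys.length = e ∧ (∀ y ∈ ys, y ∈ V) ∧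
        idealOfVars σ k ≤ (I ⊔ Ideal.ofList ys).radical := by
  classical
  induction e with
  | zero =>
    intro I hI _ _ hdim
    refine ⟨[], rfl, by simp, ?_⟩
    rw [Ideal.ofList_nil, sup_bot_eq, Ideal.radical_eq_sInf]
    refine le_sInf fun P ⟨hIP, hP⟩ => ?_
    have hcore : I ≤ (P.homogeneousCore (homogeneousSubmodule σ k)).toIdeal := by
      rw [← hI.toIdeal_homogeneousCore_eq_self]
      exact Ideal.homogeneousCore_mono _ hIP
    by_contra hcon
    have hne : ¬ idealOfVars σ k ≤ (P.homogeneousCore (homogeneousSubmodule σ k)).toIdeal :=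
      fun h => hcon (h.trans (Ideal.toIdeal_homogeneousCore_le _ _))
    have := hdim (RelSeries.singleton _ (ProjPoints.mk hP.homogeneousCore
      (HomogeneousIdeal.isHomogeneous _) hne hcore))
    omega
  | succ e ih =>
    intro I hI hV hVI hdim
    obtain ⟨y, hyV, hy⟩ : ∃ y ∈ V, ∀ P ∈ I.minimalPrimes, ¬ idealOfVars σ k ≤ P → y ∉ P := by
      have hfin : {P ∈ I.minimalPrimes | ¬ idealOfVars σ k ≤ P}.Finite :=
        (Ideal.finite_minimalPrimes_of_isNoetherianRing _ I).subset fun P h => h.1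
      let s : Finset (Subspace k V) :=
        hfin.toFinset.image fun P => (P.restrictScalars k).submoduleOf V
      have hs : (⊤ : Subspace k V) ∉ s := by
        intro htop
        obtain ⟨P, hP, hPtop⟩ := Finset.mem_image.1 htop
        rw [Set.Finite.mem_toFinset] at hP
        have hPp : P.IsPrime := hP.1.1.1
        refine hP.2 (hVI.trans (hPp.radical_le_iff.2 (sup_le hP.1.1.2 (Ideal.span_le.2 ?_))))
        intro v hv
        have : (⟨v, hv⟩ : V) ∈ (P.restrictScalars k).submoduleOf V := by rw [hPtop]; trivial
        exact this
      obtain ⟨⟨y, hyV⟩, hy⟩ := (Set.ne_univ_iff_exists_notMem _).1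
        (Subspace.biUnion_ne_univ_of_top_notMem hs)
      refine ⟨y, hyV, fun P hP hPm hyP => hy ?_⟩
      simp only [Set.mem_iUnion]
      exact ⟨_, Finset.mem_image_of_mem _ (hfin.mem_toFinset.2 ⟨hP, hPm⟩), hyP⟩
    obtain ⟨ys, hlen, hys, hrad⟩ := ih (I ⊔ Ideal.span {y})
      (hI.sup (isHomogeneous_span_singleton (hV hyV))) hV
      (hVI.trans (Ideal.radical_mono (sup_le_sup_right le_sup_left _))) (by
        intro p
        let φ : ProjPoints (I ⊔ Ideal.span {y}) → ProjPoints I :=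
          fun P => ⟨P.1, le_sup_left.trans P.2⟩
        have hφ : StrictMono φ := fun P Q h => h
        have hprime := p.head.1.isPrime
        obtain ⟨P, hP, hPle⟩ := Ideal.exists_minimalPrimes_le (I := I)
          (J := p.head.1.asHomogeneousIdeal.toIdeal) (le_sup_left.trans p.head.2)
        have hPm : ¬ idealOfVars σ k ≤ P := fun h => p.head.not_idealOfVars_le (h.trans hPle)
        have hlt : ProjPoints.mk hP.1.1 (isHomogeneous_of_mem_minimalPrimes hI hP) hPm hP.1.2 <
            (p.map φ hφ).head := by
          rw [ProjPoints.lt_iff]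
          refine lt_of_le_not_ge hPle fun hle => hy P hP hPm (hle ?_)
          exact p.head.2 (Ideal.mem_sup_right (Ideal.mem_span_singleton_self y))
        have := hdim ((p.map φ hφ).cons _ hlt)
        simp only [RelSeries.cons_length, LTSeries.map_length] at this
        omega)
    refine ⟨y :: ys, by simp [hlen], ?_, ?_⟩
    · intro z hz
      rcases List.mem_cons.1 hz with rfl | hz
      · exact hyV
      · exact hys z hz
    · rwa [Ideal.ofList_cons, ← sup_assoc]

lemma exists_forall_mem_sup_mul [Finite σ] {J K : Ideal (MvPolynomial σ k)}
    {ys : List (MvPolynomial σ k)} (hJ : J.IsHomogeneous (homogeneousSubmodule σ k))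
    (hKJ : K ≤ J) (hrad : idealOfVars σ k ≤ (K ⊔ Ideal.ofList ys).radical) :
    ∃ D : ℕ, ∀ n ≥ D, ∀ f ∈ J, f ∈ homogeneousSubmodule σ k n →
      f ∈ K ⊔ Ideal.ofList ys * J := by
  classical
  obtain ⟨m, hm⟩ := Ideal.exists_radical_pow_le_of_fg (K ⊔ Ideal.ofList ys)
    (IsNoetherian.noetherian _)
  have hpow : idealOfVars σ k ^ m ≤ K ⊔ Ideal.ofList ys := (Ideal.pow_right_mono hrad m).trans hm
  obtain ⟨G, rfl⟩ : J.FG := IsNoetherian.noetherian _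
  set J := Ideal.span (G : Set (MvPolynomial σ k)) with hJdef
  refine ⟨m + G.sup totalDegree + 1, fun n hn f hf hfn => ?_⟩
  suffices h : f ∈ idealOfVars σ k ^ m * J by
    have h₁ := Ideal.mul_mono hpow le_rfl h
    rw [Ideal.sup_mul] at h₁
    exact sup_le_sup_right (Ideal.mul_le_left (I := K) (J := J)) _ h₁
  have hhom : (idealOfVars σ k ^ m * J).IsHomogeneous (homogeneousSubmodule σ k) := by
    refine Ideal.IsHomogeneous.mul ?_ hJ
    have hp : ∀ n, (idealOfVars σ k ^ n).IsHomogeneous (homogeneousSubmodule σ k) := by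
      intro n
      induction n with
      | zero => simpa using Ideal.IsHomogeneous.top _
      | succ n ih => rw [pow_succ]; exact ih.mul isHomogeneous_idealOfVars
    exact hp m
  obtain ⟨a, ha⟩ := Submodule.mem_span_finset'.1 hf
  let low : MvPolynomial σ k → MvPolynomial σ k := fun c =>
    ∑ i ∈ Finset.range m, homogeneousComponent i c
  have hlow : ∀ c, c - low c ∈ idealOfVars σ k ^ m := by
    intro c
    rw [mem_pow_idealOfVars_iff']
    intro x hx
    simp only [low, coeff_sub, coeff_sum, coeff_homogeneousComponent]
    rw [Finset.sum_ite_eq]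
    simp [hx]
  have hlowdeg : ∀ c, (low c).totalDegree ≤ m := fun c =>
    totalDegree_finsetSum_le fun i hi =>
      (homogeneousComponent_isHomogeneous i c).totalDegree_le.trans (Finset.mem_range.1 hi).le
  have hsplit : f = ∑ g : G, (a g - low (a g)) * (g : MvPolynomial σ k) +
      ∑ g : G, low (a g) * (g : MvPolynomial σ k) := by
    rw [← ha, ← Finset.sum_add_distrib]
    refine Finset.sum_congr rfl fun g _ => ?_
    rw [smul_eq_mul]
    ring
  have hzero : homogeneousComponent n (∑ g : G, low (a g) * (g : MvPolynomial σ k)) = 0 := by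
    rw [map_sum]
    refine Finset.sum_eq_zero fun g _ => homogeneousComponent_eq_zero _ _ ?_
    have h₁ := totalDegree_mul (low (a g)) (g : MvPolynomial σ k)
    have h₂ := hlowdeg (a g)
    have h₃ : (g : MvPolynomial σ k).totalDegree ≤ G.sup totalDegree := Finset.le_sup g.2
    omega
  rw [← homogeneousComponent_self hfn, hsplit, map_add, hzero, add_zero]
  refine isHomogeneous_ideal_iff.1 hhom _ (Ideal.sum_mem _ fun g _ => ?_) n
  exact Ideal.mul_mem_mul (hlow _) (Ideal.subset_span g.2)

end Dimension

section CohenMacaulay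

open RingTheory.Sequence

variable {σ : Type} {k : Type u} [Field k]

lemma regularOn_of_isWeaklyRegular {I : Ideal (MvPolynomial σ k)}
    (hI : I.IsHomogeneous (homogeneousSubmodule σ k))
    {R : Type u} [CommRing R] (ψ : MvPolynomial σ k →+* R) (hψI : ∀ f ∈ I, ψ f = 0)
    (hψ : ∀ (J : Ideal (MvPolynomial σ k)) (f : MvPolynomial σ k), ψ f ∈ J.map ψ →
      ∃ c, coeff 0 c ≠ 0 ∧ c * f ∈ I ⊔ J)
    (ys : List (MvPolynomial σ k)) :
    ∀ pre : List (MvPolynomial σ k), (∀ y ∈ pre ++ ys, y ∈ homogeneousSubmodule σ k 1) →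
      IsWeaklyRegular R ((pre ++ ys).map ψ) → RegularOn ⊤ (I ⊔ Ideal.ofList pre) ys := by
  induction ys with
  | nil => intros; trivial
  | cons y ys ih =>
    intro pre hhom hreg
    refine ⟨fun f _ hf => ?_, ?_⟩
    · rw [List.map_append, List.map_cons, isWeaklyRegular_append_iff,
        isWeaklyRegular_cons_iff] at hreg
      have h₁ := (isSMulRegular_quotient_iff_mem_of_smul_mem _ _).1 hreg.2.1 (ψ f) (by
        simp only [smul_eq_mul, Ideal.mul_top, ← map_mul, ← Ideal.map_ofList]
        obtain ⟨i, hi, v, hv, hiv⟩ := Submodule.mem_sup.1 hf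
        rw [← hiv, map_add, hψI i hi, zero_add]
        exact Ideal.mem_map_of_mem _ hv)
      rw [smul_eq_mul, Ideal.mul_top, ← Ideal.map_ofList] at h₁
      obtain ⟨c, hc, hcf⟩ := hψ _ f h₁
      exact mem_of_mul_mem_of_coeff_ne_zero (hI.sup (isHomogeneous_ofList fun z hz =>
        hhom z (by simp [hz]))) hc hcf
    · have := ih (pre ++ [y]) (by simpa using hhom) (by simpa using hreg)
      rwa [Ideal.ofList_append, Ideal.ofList_singleton, ← sup_assoc, ← Ideal.mul_top (Ideal.span {y})]
        at this

lemma length_succ_le_height_map_idealOfVars {I : Ideal (MvPolynomial σ k)}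
    (hIm : I ≤ idealOfVars σ k) (p : LTSeries (ProjPoints I)) :
    ((p.length + 1 : ℕ) : ℕ∞) ≤ ((idealOfVars σ k).map (Ideal.Quotient.mk I)).height := by
  have hmax : (idealOfVars σ k).IsMaximal := isMaximal_idealOfVars
  have hker : RingHom.ker (Ideal.Quotient.mk I) ≤ idealOfVars σ k := by rwa [Ideal.mk_ker]
  have hm : ((idealOfVars σ k).map (Ideal.Quotient.mk I)).IsMaximal :=
    Ideal.IsMaximal.map_of_surjective_of_ker_le Ideal.Quotient.mk_surjective hker
  let e := I.primeSpectrumQuotientOrderIsoZeroLocus.symm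
  let φ : ProjPoints I → PrimeSpectrum (MvPolynomial σ k ⧸ I) := fun P =>
    e ⟨⟨P.1.asHomogeneousIdeal.toIdeal, P.1.isPrime⟩, P.2⟩
  have hφ : StrictMono φ := fun P Q h => e.strictMono h
  let top : PrimeSpectrum (MvPolynomial σ k ⧸ I) := e ⟨⟨idealOfVars σ k, hmax.isPrime⟩, hIm⟩
  have htop : top = ⟨(idealOfVars σ k).map (Ideal.Quotient.mk I), hm.isPrime⟩ := by
    rfl
  have hlt : (p.map φ hφ).last < top := by
    rw [LTSeries.last_map]
    refine e.strictMono (lt_of_le_not_ge (?_ : p.last.1.asHomogeneousIdeal.toIdeal ≤ _)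
      p.last.not_idealOfVars_le)
    exact le_idealOfVars (HomogeneousIdeal.isHomogeneous _) p.last.1.isPrime.ne_top
  have := Order.length_le_height_last (p := (p.map φ hφ).snoc top hlt)
  rw [RelSeries.last_snoc] at this
  have h : top.asIdeal.height = ((idealOfVars σ k).map (Ideal.Quotient.mk I)).height := by
    rw [htop]
  rw [← h, PrimeSpectrum.height_eq_orderHeight]
  exact_mod_cast this

lemma regularOn_of_isLocalization [Finite σ] {I : Ideal (MvPolynomial σ k)}
    (hI : I.IsHomogeneous (homogeneousSubmodule σ k))
    {R : Type u} [CommRing R] [IsLocalRing R] [IsNoetherianRing R] (ψ : MvPolynomial σ k →+* R)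
    (hψm : (idealOfVars σ k).map ψ = IsLocalRing.maximalIdeal R) (hψI : ∀ f ∈ I, ψ f = 0)
    (hψ : ∀ (J : Ideal (MvPolynomial σ k)) (f : MvPolynomial σ k), ψ f ∈ J.map ψ →
      ∃ c, coeff 0 c ≠ 0 ∧ c * f ∈ I ⊔ J)
    {ys : List (MvPolynomial σ k)} (hys : ∀ y ∈ ys, y ∈ homogeneousSubmodule σ k 1)
    (hrad : idealOfVars σ k ≤ (I ⊔ Ideal.ofList ys).radical)
    {rs : List R} (hmem : ∀ r ∈ rs, r ∈ IsLocalRing.maximalIdeal R) (hreg : IsRegular R rs)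
    (hle : ys.length ≤ rs.length) : RegularOn ⊤ I ys := by
  have hψys : ∀ z ∈ ys.map ψ, z ∈ IsLocalRing.maximalIdeal R := by
    intro z hz
    obtain ⟨y, hy, rfl⟩ := List.mem_map.1 hz
    rw [← hψm]
    exact Ideal.mem_map_of_mem _ (mem_idealOfVars_of_mem (hys y hy))
  have hψrad : IsLocalRing.maximalIdeal R ≤ (Ideal.ofList (ys.map ψ)).radical := by
    rw [← hψm, Ideal.map_le_iff_le_comap]
    intro f hf
    obtain ⟨n, hn⟩ := hrad hf
    refine ⟨n, ?_⟩
    rw [← map_pow, ← Ideal.map_ofList]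
    obtain ⟨i, hi, v, hv, hiv⟩ := Submodule.mem_sup.1 hn
    rw [← hiv, map_add, hψI i hi, zero_add]
    exact Ideal.mem_map_of_mem _ hv
  have hlen : rs.length = ys.length := by
    refine le_antisymm ?_ hle
    obtain ⟨P, hP⟩ := associatedPrimes.nonempty R R
    have hPp : P.IsPrime := IsAssociatedPrime.isPrime hP
    have h₁ := le_ringKrullDim_quotient_of_isAssociatedPrime rs R hmem hreg P hP
    have h₂ := ringKrullDim_quotient_le_length (P := P) (ys := ys.map ψ)
      (hψrad.trans (Ideal.radical_mono le_sup_right)) hψys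
    rw [List.length_map] at h₂
    exact_mod_cast h₁.trans h₂
  have hweak := isWeaklyRegular_of_hasRegularSequence (ys.map ψ) R
    ⟨rs, by rw [hlen, List.length_map], hmem, hreg⟩ hψys
    (hψrad.trans (Ideal.radical_mono le_sup_right))
  simpa using regularOn_of_isWeaklyRegular hI ψ hψI hψ ys [] (by simpa using hys)
    (by simpa using hweak)

/-- A homogeneous linear system of parameters of a Cohen-Macaulay graded ring is a regular
sequence. -/
theorem regularOn_of_isCohenMacaulayRing [Finite σ] {I : Ideal (MvPolynomial σ k)}
    (hI : I.IsHomogeneous (homogeneousSubmodule σ k)) (hIm : I ≤ idealOfVars σ k)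
    (hCM : IsCohenMacaulayRing (MvPolynomial σ k ⧸ I)) {ys : List (MvPolynomial σ k)}
    (hys : ∀ y ∈ ys, y ∈ homogeneousSubmodule σ k 1)
    (hrad : idealOfVars σ k ≤ (I ⊔ Ideal.ofList ys).radical)
    (p : LTSeries (ProjPoints I)) (hp : p.length + 1 = ys.length) : RegularOn ⊤ I ys := by
  have hmax : (idealOfVars σ k).IsMaximal := isMaximal_idealOfVars
  have hker : RingHom.ker (Ideal.Quotient.mk I) ≤ idealOfVars σ k := by rwa [Ideal.mk_ker]
  have hm : ((idealOfVars σ k).map (Ideal.Quotient.mk I)).IsMaximal :=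
    Ideal.IsMaximal.map_of_surjective_of_ker_le Ideal.Quotient.mk_surjective hker
  have hle := length_succ_le_height_map_idealOfVars hIm p
  obtain ⟨rs, hmem, hreg, hdim⟩ := hCM.2 ((idealOfVars σ k).map (Ideal.Quotient.mk I))
  generalize hmdef : (idealOfVars σ k).map (Ideal.Quotient.mk I) = m at *
  have hN : IsNoetherianRing (Localization.AtPrime m) := inferInstance
  rw [IsLocalization.AtPrime.ringKrullDim_eq_height m] at hdim
  refine regularOn_of_isLocalization hI
    ((algebraMap _ (Localization.AtPrime m)).comp (Ideal.Quotient.mk I)) ?_ ?_ ?_ hys hrad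
    hmem hreg ?_
  · rw [← Ideal.map_map, hmdef]
    exact Localization.AtPrime.map_eq_maximalIdeal
  · intro f hf
    simp [Ideal.Quotient.eq_zero_iff_mem.2 hf]
  · intro J f hf
    rw [← Ideal.map_map, RingHom.comp_apply] at hf
    obtain ⟨c, hc, hcf⟩ := (IsLocalization.algebraMap_mem_map_algebraMap_iff m.primeCompl
      (Localization.AtPrime m) _ _).1 hf
    obtain ⟨c, rfl⟩ := Ideal.Quotient.mk_surjective c
    refine ⟨c, fun h => hc ?_, ?_⟩
    · rw [← hmdef]
      exact Ideal.mem_map_of_mem _ (mem_idealOfVars_iff.2 h)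
    · rw [← map_mul, Ideal.mem_quotient_iff_mem_sup] at hcf
      rwa [sup_comm]
  · rw [← hp]
    have : ((m.height : ℕ∞) : WithBot ℕ∞) = ((rs.length : ℕ∞) : WithBot ℕ∞) := hdim.symm
    rw [WithBot.coe_inj] at this
    rw [this] at hle
    exact_mod_cast hle

/-- A sequence of linear forms which is regular modulo a proper homogeneous ideal is linearly
independent modulo this ideal. -/
lemma RegularOn.eq_zero_of_sum_mem {ys : List (MvPolynomial σ k)} :
    ∀ {K : Ideal (MvPolynomial σ k)}, K ≤ idealOfVars σ k →
      (∀ y ∈ ys, y ∈ homogeneousSubmodule σ k 1) → RegularOn ⊤ K ys →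
      ∀ c : Fin ys.length → k, ∑ i, C (c i) * ys.get i ∈ K → ∀ i, c i = 0 := by
  induction ys with
  | nil => intro K _ _ _ c _ i; exact i.elim0
  | cons y ys ih =>
    intro K hK hys hreg c hc
    have hyK : K ⊔ Ideal.span {y} * ⊤ ≤ idealOfVars σ k := by
      rw [Ideal.mul_top]
      exact sup_le hK ((Ideal.span_singleton_le_iff_mem _).2
        (mem_idealOfVars_of_mem (hys y (by simp))))
    have hc' : C (c 0) * y + ∑ i : Fin ys.length, C (c i.succ) * ys.get i ∈ K := by
      have := hc
      simp only [List.length_cons] at this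
      rw [Fin.sum_univ_succ] at this
      simpa using this
    have hsucc := ih hyK (fun z hz => hys z (by simp [hz])) hreg.2 (fun i => c i.succ) (by
      rw [← add_sub_cancel_left (C (c 0) * y) (∑ i : Fin ys.length, C (c i.succ) * ys.get i)]
      refine Ideal.sub_mem _ (Ideal.mem_sup_left hc') (Ideal.mem_sup_right ?_)
      rw [Ideal.mul_top]
      exact Ideal.mul_mem_left _ _ (Ideal.mem_span_singleton_self y))
    intro i
    refine Fin.cases ?_ hsucc i
    simp only [hsucc, C_0, zero_mul, Finset.sum_const_zero, add_zero] at hc'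
    have := mem_idealOfVars_iff.1 (hK (hreg.1 (C (c 0)) trivial (by rwa [mul_comm])))
    simpa using this

end CohenMacaulay

namespace ClosedSubscheme

variable {k : Type u} [Field k] {N : ℕ}

/-- The fraction `f / X_i^n` is a section of the ideal sheaf on `D₊(X_i)`. -/
def IsSectionOn (I : ClosedSubscheme k N) (i : Fin (N + 1)) (n : ℕ) (f : CoordRing k N) : Prop :=
  ∃ hf : f ∈ homogeneousSubmodule (Fin (N + 1)) k (n • 1),
    HomogeneousLocalization.Away.mk _ (X_mem i) n f hf ∈ chartIdeal I i

variable {I : ClosedSubscheme k N} {i : Fin (N + 1)} {n : ℕ} {f g : CoordRing k N}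

lemma IsSectionOn.mem (h : IsSectionOn I i n f) :
    f ∈ homogeneousSubmodule (Fin (N + 1)) k n := by
  simpa using h.1

lemma isSectionOn_zero : IsSectionOn I i n 0 := by
  refine ⟨Submodule.zero_mem _, ?_⟩
  convert Ideal.zero_mem _
  apply HomogeneousLocalization.val_injective
  simp [HomogeneousLocalization.Away.val_mk, Localization.mk_zero]

lemma IsSectionOn.add (hf : IsSectionOn I i n f) (hg : IsSectionOn I i n g) :
    IsSectionOn I i n (f + g) := by
  obtain ⟨hf, hf'⟩ := hf
  obtain ⟨hg, hg'⟩ := hg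
  refine ⟨Submodule.add_mem _ hf hg, ?_⟩
  convert Ideal.add_mem _ hf' hg'
  apply HomogeneousLocalization.val_injective
  simp [HomogeneousLocalization.Away.val_mk, Localization.add_mk_self]

lemma IsSectionOn.mul {m : ℕ} (hg : g ∈ homogeneousSubmodule (Fin (N + 1)) k m)
    (hf : IsSectionOn I i n f) : IsSectionOn I i (m + n) (g * f) := by
  obtain ⟨hf, hf'⟩ := hf
  refine ⟨?_, ?_⟩
  · simpa using IsHomogeneous.mul hg (by simpa using hf)
  · convert Ideal.mul_mem_left _ (HomogeneousLocalization.Away.mk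
      (homogeneousSubmodule (Fin (N + 1)) k) (X_mem i) m g (by simpa using hg)) hf'
    apply HomogeneousLocalization.val_injective
    simp [HomogeneousLocalization.Away.val_mk, Localization.mk_mul, pow_add]

lemma IsSectionOn.of_mul_eq {m : ℕ} (hf : IsSectionOn I i n f)
    (hg : g ∈ homogeneousSubmodule (Fin (N + 1)) k m) (h : X i ^ n * g = X i ^ m * f) :
    IsSectionOn I i m g := by
  obtain ⟨hf, hf'⟩ := hf
  refine ⟨by simpa using hg, ?_⟩
  convert hf' using 1
  apply HomogeneousLocalization.val_injective
  simp only [HomogeneousLocalization.Away.val_mk]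
  rw [Localization.mk_eq_mk_iff, Localization.r_iff_exists]
  exact ⟨1, by simpa using h⟩

lemma algebraMap_X_ne_zero :
    algebraMap (CoordRing k N) (FractionRing (CoordRing k N)) (X i) ≠ 0 := by
  simp [X_ne_zero]

/-- The forms of degree `n` which are sections of `𝓘(n)` are those which are so on each `D₊(X_i)`. -/
lemma algebraMap_mem_twistedSections_iff (hf : f ∈ homogeneousSubmodule (Fin (N + 1)) k n) :
    algebraMap (CoordRing k N) (FractionRing (CoordRing k N)) f ∈ twistedSections I (n : ℤ) ↔
      ∀ i, IsSectionOn I i n f := by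
  constructor
  · intro h i
    obtain ⟨m, a, ha, haI, heq⟩ := h i
    refine IsSectionOn.of_mul_eq ⟨ha, haI⟩ hf
      (IsFractionRing.injective (CoordRing k N) (FractionRing (CoordRing k N)) ?_)
    have := algebraMap_X_ne_zero (k := k) (i := i)
    rw [map_mul, heq, map_mul, map_pow, map_pow, zpow_natCast]
    field_simp
  · intro h i
    obtain ⟨hf', hI⟩ := h i
    refine ⟨n, f, hf', hI, ?_⟩
    have := algebraMap_X_ne_zero (k := k) (i := i)
    rw [zpow_natCast]
    field_simp

lemma mem_homogeneousSubmodule_of_X_pow_mul {p q : ℕ}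
    (h : X i ^ p * f ∈ homogeneousSubmodule (Fin (N + 1)) k q) :
    (p ≤ q → f ∈ homogeneousSubmodule (Fin (N + 1)) k (q - p)) ∧ (q < p → f = 0) := by
  have hX : (X i : CoordRing k N) ^ p ∈ homogeneousSubmodule (Fin (N + 1)) k p := by
    simpa using (isHomogeneous_X k i).pow p
  have key : ∀ j, j + p ≠ q → homogeneousComponent j f = 0 := by
    intro j hj
    have h₁ := homogeneousComponent_mul_right hX f (j + p)
    rw [if_pos (Nat.le_add_left _ _), Nat.add_sub_cancel, mul_comm f,
      homogeneousComponent_of_mem h, if_neg hj] at h₁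
    exact (mul_eq_zero.1 h₁.symm).resolve_right (pow_ne_zero _ (X_ne_zero i))
  constructor
  · intro hpq
    rw [← sum_homogeneousComponent f]
    refine Submodule.sum_mem _ fun j _ => ?_
    by_cases hj : j + p = q
    · rw [show q - p = j by omega]
      exact homogeneousComponent_isHomogeneous j f
    · rw [key j hj]
      exact Submodule.zero_mem _
  · intro hqp
    rw [← sum_homogeneousComponent f]
    exact Finset.sum_eq_zero fun j _ => key j (by omega)

/-- On a projective space of positive dimension, the sections of `𝓘(n)` are forms of degree `n`. -/
lemma exists_of_mem_twistedSections (hN : 0 < N) {n : ℤ} {g : FractionRing (CoordRing k N)}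
    (hg : g ∈ twistedSections I n) :
    ∃ f, algebraMap (CoordRing k N) _ f = g ∧ (n < 0 → f = 0) ∧
      (0 ≤ n → f ∈ homogeneousSubmodule (Fin (N + 1)) k n.toNat) := by
  have hpq : ∀ i, ∃ (p q : ℕ) (a : CoordRing k N), a ∈ homogeneousSubmodule (Fin (N + 1)) k q ∧
      (q : ℤ) - p = n ∧ algebraMap (CoordRing k N) _ a =
        algebraMap (CoordRing k N) (FractionRing (CoordRing k N)) (X i) ^ p * g := by
    intro i
    obtain ⟨m, a, ha, -, rfl⟩ := hg i
    have h0 := algebraMap_X_ne_zero (k := k) (i := i)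
    have ha : a ∈ homogeneousSubmodule (Fin (N + 1)) k m := by simpa using ha
    obtain ⟨r, rfl | rfl⟩ := n.eq_nat_or_neg
    · refine ⟨m, r + m, X i ^ r * a, ?_, by push_cast; ring, ?_⟩
      · have := (isHomogeneous_X k i).pow r
        rw [one_mul] at this
        exact this.mul ha
      · rw [map_mul, map_pow, zpow_natCast]
        field_simp
    · refine ⟨m + r, m, a, ha, by push_cast; ring, ?_⟩
      rw [zpow_neg, zpow_natCast]
      field_simp
      ring
  let i₀ : Fin (N + 1) := 0
  let i₁ : Fin (N + 1) := Fin.last N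
  have hne : i₀ ≠ i₁ := by
    intro h
    have := congrArg Fin.val h
    simp [i₀, i₁] at this
    omega
  obtain ⟨p, q, a, ha, hpqn, hag⟩ := hpq i₀
  obtain ⟨p', q', b, hb, -, hbg⟩ := hpq i₁
  have hab : X i₁ ^ p' * a = X i₀ ^ p * b := by
    apply IsFractionRing.injective (CoordRing k N) (FractionRing (CoordRing k N))
    rw [map_mul, map_mul, hag, hbg, map_pow, map_pow]
    ring
  have hndvd : ¬ (X i₀ : CoordRing k N) ∣ X i₁ ^ p' := by
    intro h
    have := (X_prime (R := k) (i := i₀)).dvd_of_dvd_pow h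
    rw [X_dvd_X] at this
    exact hne (by simpa using this)
  obtain ⟨f, rfl⟩ := (X_prime (R := k) (i := i₀)).pow_dvd_of_dvd_mul_left p hndvd ⟨b, hab⟩
  have hf := mem_homogeneousSubmodule_of_X_pow_mul ha
  refine ⟨f, ?_, fun h => hf.2 (by omega), fun h => ?_⟩
  · rw [map_mul, map_pow] at hag
    exact mul_left_cancel₀ (pow_ne_zero _ algebraMap_X_ne_zero) hag
  · have := hf.1 (by omega)
    rwa [show q - p = n.toNat by omega] at this

/-- The saturated ideal consists of the polynomials whose components are sections. -/
lemma mem_satIdeal_iff : f ∈ satIdeal I ↔ ∀ n i, IsSectionOn I i n (homogeneousComponent n f) := by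
  let Z : Ideal (CoordRing k N) :=
    { carrier := {f | ∀ n i, IsSectionOn I i n (homogeneousComponent n f)}
      zero_mem' := fun n i => by rw [map_zero]; exact isSectionOn_zero
      add_mem' := fun ha hb n i => by rw [map_add]; exact (ha n i).add (hb n i)
      smul_mem' := by
        intro c f hf n i
        have hsum : homogeneousComponent n (c • f) = ∑ j ∈ Finset.range (c.totalDegree + 1),
            homogeneousComponent n (homogeneousComponent j c * f) := by
          rw [← map_sum, ← Finset.sum_mul, sum_homogeneousComponent, smul_eq_mul]
        rw [hsum]
        refine Finset.sum_induction _ (IsSectionOn I i n) (fun _ _ => IsSectionOn.add)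
          isSectionOn_zero fun j _ => ?_
        rw [mul_comm, homogeneousComponent_mul_right (homogeneousComponent_isHomogeneous j c)]
        split_ifs with hj
        · have := (hf (n - j) i).mul (homogeneousComponent_isHomogeneous j c)
          rwa [Nat.add_sub_cancel' hj, mul_comm] at this
        · rw [zero_mul]
          exact isSectionOn_zero }
  have hZ : satIdeal I = Z := by
    apply le_antisymm
    · refine Ideal.span_le.2 ?_
      rintro f ⟨m, hf, hfI⟩ n i
      rw [homogeneousComponent_of_mem hf]
      split_ifs with h
      · rw [h]
        exact (algebraMap_mem_twistedSections_iff hf).1 hfI i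
      · exact isSectionOn_zero
    · intro f hf
      rw [← sum_homogeneousComponent f]
      refine Ideal.sum_mem _ fun n _ => Ideal.subset_span
        ⟨n, homogeneousComponent_isHomogeneous n f, ?_⟩
      exact (algebraMap_mem_twistedSections_iff (homogeneousComponent_isHomogeneous n f)).2 (hf n)
  rw [hZ]
  rfl

lemma mem_satIdeal_iff_of_mem (hf : f ∈ homogeneousSubmodule (Fin (N + 1)) k n) :
    f ∈ satIdeal I ↔ ∀ i, IsSectionOn I i n f := by
  rw [mem_satIdeal_iff]
  constructor
  · intro h i
    simpa [homogeneousComponent_self hf] using h n i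
  · intro h m i
    rw [homogeneousComponent_of_mem hf]
    split_ifs with hm
    · rw [hm]
      exact h i
    · exact isSectionOn_zero

lemma isHomogeneous_satIdeal (I : ClosedSubscheme k N) :
    (satIdeal I).IsHomogeneous (homogeneousSubmodule (Fin (N + 1)) k) := by
  rw [isHomogeneous_ideal_iff]
  intro f hf n
  rw [mem_satIdeal_iff_of_mem (homogeneousComponent_isHomogeneous n f)]
  exact mem_satIdeal_iff.1 hf n

lemma satIdeal_mono {I J : ClosedSubscheme k N} (h : I ≤ J) : satIdeal I ≤ satIdeal J := by
  intro f hf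
  rw [mem_satIdeal_iff] at hf ⊢
  intro n i
  obtain ⟨h₁, h₂⟩ := hf n i
  exact ⟨h₁, h (chart k N i) h₂⟩

lemma h0_eq_hilbertFun (hN : 0 < N) (I : ClosedSubscheme k N) : h0 I = hilbertFun (satIdeal I) := by
  funext n
  rcases lt_or_ge n 0 with hn | hn
  · rw [hilbertFun_of_neg _ hn, h0]
    have : twistedSections I n = ⊥ := by
      rw [eq_bot_iff]
      intro g hg
      obtain ⟨f, rfl, hf, -⟩ := exists_of_mem_twistedSections hN hg
      rw [hf hn, map_zero]
      exact Submodule.zero_mem _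
    rw [this, finrank_bot, Nat.cast_zero]
  · obtain ⟨n, rfl⟩ := Int.eq_ofNat_of_zero_le hn
    rw [hilbertFun_natCast, h0]
    let φ : CoordRing k N →ₗ[k] FractionRing (CoordRing k N) :=
      (Algebra.linearMap (CoordRing k N) (FractionRing (CoordRing k N))).restrictScalars k
    have hφ : Function.Injective φ :=
      IsFractionRing.injective (CoordRing k N) (FractionRing (CoordRing k N))
    have : twistedSections I n = (gradedPiece (satIdeal I) n).map φ := by
      ext g
      constructor
      · intro hg
        obtain ⟨f, rfl, -, hf⟩ := exists_of_mem_twistedSections hN hg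
        have hf : f ∈ homogeneousSubmodule (Fin (N + 1)) k n := hf hn
        exact ⟨f, ⟨(mem_satIdeal_iff_of_mem hf).2
          ((algebraMap_mem_twistedSections_iff hf).1 hg), hf⟩, rfl⟩
      · rintro ⟨f, ⟨hfI, hf⟩, rfl⟩
        exact (algebraMap_mem_twistedSections_iff hf).2 ((mem_satIdeal_iff_of_mem hf).1 hfI)
    rw [this, ((gradedPiece (satIdeal I) n).equivMapOfInjective φ hφ).symm.finrank_eq]

end ClosedSubscheme

namespace ClosedSubscheme

variable {k : Type u} [Field k] {N : ℕ} {I : ClosedSubscheme k N} {i : Fin (N + 1)} {n : ℕ}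
  {f : CoordRing k N}

lemma mem_basicOpen_chartHom_iff {x : ProjSpace k N} (hx : x ∈ (chart k N i).1)
    (hf : f ∈ homogeneousSubmodule (Fin (N + 1)) k (n • 1)) :
    x ∈ (ProjSpace k N).basicOpen
      (chartHom k N i (HomogeneousLocalization.Away.mk _ (X_mem i) n f hf)) ↔
      f ∉ x.asHomogeneousIdeal.toIdeal := by
  rw [Scheme.mem_basicOpen _ _ _ hx]
  have h := CategoryTheory.ConcreteCategory.congr_hom (ProjectiveSpectrum.Proj.awayToSection_germ
    (homogeneousSubmodule (Fin (N + 1)) k) (X i : CoordRing k N) x hx)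
    (HomogeneousLocalization.Away.mk _ (X_mem i) n f hf)
  have h' : (ProjSpace k N).presheaf.germ (chart k N i).1 x hx
      (chartHom k N i (HomogeneousLocalization.Away.mk _ (X_mem i) n f hf)) =
      (Proj.stalkIso' (homogeneousSubmodule (Fin (N + 1)) k) x).symm
        (HomogeneousLocalization.mapId (homogeneousSubmodule (Fin (N + 1)) k)
          (Submonoid.powers_le.mpr hx)
          (HomogeneousLocalization.Away.mk _ (X_mem i) n f hf)) := h
  rw [h']
  have hp : x.asHomogeneousIdeal.toIdeal.IsPrime := x.isPrime
  refine (isUnit_map_iff (Proj.stalkIso' (homogeneousSubmodule (Fin (N + 1)) k) x).symm _).trans ?_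
  rw [← HomogeneousLocalization.isUnit_iff_isUnit_val]
  have hXn : (X i : CoordRing k N) ^ n ∈ x.asHomogeneousIdeal.toIdeal.primeCompl :=
    pow_mem (show (X i : CoordRing k N) ∈ x.asHomogeneousIdeal.toIdeal.primeCompl from hx) n
  have hval : (HomogeneousLocalization.mapId (homogeneousSubmodule (Fin (N + 1)) k)
      (Submonoid.powers_le.mpr hx)
      (HomogeneousLocalization.Away.mk _ (X_mem i) n f hf)).val =
      IsLocalization.mk' (Localization x.asHomogeneousIdeal.toIdeal.primeCompl) f
        (⟨X i ^ n, hXn⟩ : x.asHomogeneousIdeal.toIdeal.primeCompl) := by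
    rw [← Localization.mk_eq_mk']
    rfl
  rw [hval, IsLocalization.AtPrime.isUnit_mk'_iff _ x.asHomogeneousIdeal.toIdeal]
  rfl

lemma mem_map_of_square {A A' B B' C C' : Type*} [CommRing A] [CommRing A'] [CommRing B]
    [CommRing B'] [CommRing C] [CommRing C'] {σ : A →+* A'} {τ : B →+* B'} (e : C →+* C')
    (he : Function.Bijective e) (hτ : Function.Surjective τ) {r : A' →+* C'} {s : B' →+* C'}
    {α : A →+* C} {β : B →+* C} (hα : e.comp α = r.comp σ) (hβ : e.comp β = s.comp τ)
    {IA : Ideal A'} {IB : Ideal B'} {IC : Ideal C'} (hA : IA ≤ IC.comap r) (hB : IB.map s = IC)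
    {t : A} (ht : t ∈ IA.comap σ) : α t ∈ (IB.comap τ).map β := by
  have h₁ : e (α t) ∈ IC := by
    rw [show e (α t) = r (σ t) from DFunLike.congr_fun hα t]
    exact hA ht
  rw [← hB, ← Ideal.map_comap_of_surjective τ hτ IB, Ideal.map_map, ← hβ, ← Ideal.map_map] at h₁
  obtain ⟨a, ha, hae⟩ := (Ideal.mem_map_iff_of_surjective e he.2).1 h₁
  rwa [← he.1 hae]

lemma bijective_chartHom (i : Fin (N + 1)) : Function.Bijective (chartHom k N i) :=
  (Proj.basicOpenIsoAway (homogeneousSubmodule (Fin (N + 1)) k) (X i) (X_mem i)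
    one_pos).commRingCatIsoToRingEquiv.bijective

/-- The affine open `D₊(X_i X_j)`. -/
def chartInter (k : Type u) [Field k] (N : ℕ) (i j : Fin (N + 1)) : (ProjSpace k N).affineOpens :=
  ⟨Proj.basicOpen (homogeneousSubmodule (Fin (N + 1)) k) (X i * X j),
    Proj.isAffineOpen_basicOpen _ (X i * X j) (SetLike.mul_mem_graded (X_mem i) (X_mem j))
      (by norm_num)⟩

lemma chartInter_le_left (i j : Fin (N + 1)) : chartInter k N i j ≤ chart k N i :=
  Proj.basicOpen_mono _ _ _ ⟨X j, rfl⟩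

lemma chartInter_le_right (i j : Fin (N + 1)) : chartInter k N i j ≤ chart k N j :=
  Proj.basicOpen_mono _ _ _ ⟨X i, mul_comm _ _⟩

/-- The canonical isomorphism `S_{(X_i X_j)} ≃ Γ(D₊(X_i X_j), 𝓞)`. -/
def chartInterHom (k : Type u) [Field k] (N : ℕ) (i j : Fin (N + 1)) :
    HomogeneousLocalization.Away (homogeneousSubmodule (Fin (N + 1)) k)
      (X i * X j : CoordRing k N) →+* Γ(ProjSpace k N, (chartInter k N i j).1) :=
  (Proj.awayToSection (homogeneousSubmodule (Fin (N + 1)) k) (X i * X j)).hom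

lemma bijective_chartInterHom (i j : Fin (N + 1)) : Function.Bijective (chartInterHom k N i j) :=
  (Proj.basicOpenIsoAway (homogeneousSubmodule (Fin (N + 1)) k) (X i * X j)
    (SetLike.mul_mem_graded (X_mem i) (X_mem j)) (by norm_num)).commRingCatIsoToRingEquiv.bijective

lemma chartInterHom_comp_left (i j : Fin (N + 1)) :
    (chartInterHom k N i j).comp (HomogeneousLocalization.awayMap
      (homogeneousSubmodule (Fin (N + 1)) k) (X_mem j) rfl) =
    ((ProjSpace k N).presheaf.map (CategoryTheory.homOfLE (chartInter_le_left i j)).op).hom.comp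
      (chartHom k N i) :=
  congrArg CommRingCat.Hom.hom (Proj.awayMap_awayToSection
    (homogeneousSubmodule (Fin (N + 1)) k) (f := X i) (X_mem j) rfl)

lemma chartInterHom_comp_right (i j : Fin (N + 1)) :
    (chartInterHom k N i j).comp (HomogeneousLocalization.awayMap
      (homogeneousSubmodule (Fin (N + 1)) k) (X_mem i) (mul_comm (X i) (X j))) =
    ((ProjSpace k N).presheaf.map (CategoryTheory.homOfLE (chartInter_le_right i j)).op).hom.comp
      (chartHom k N j) :=
  congrArg CommRingCat.Hom.hom (Proj.awayMap_awayToSection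
    (homogeneousSubmodule (Fin (N + 1)) k) (f := X j) (X_mem i) (mul_comm (X i) (X j)))

lemma awayMap_mem_map (I : ClosedSubscheme k N) (i j : Fin (N + 1))
    {t : HomogeneousLocalization.Away (homogeneousSubmodule (Fin (N + 1)) k)
      (X i : CoordRing k N)} (ht : t ∈ chartIdeal I i) :
    HomogeneousLocalization.awayMap (homogeneousSubmodule (Fin (N + 1)) k) (X_mem j)
        (rfl : (X i * X j : CoordRing k N) = X i * X j) t ∈
      (chartIdeal I j).map (HomogeneousLocalization.awayMap
        (homogeneousSubmodule (Fin (N + 1)) k) (X_mem i)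
        (mul_comm (X i) (X j) : (X i * X j : CoordRing k N) = X j * X i)) :=
  mem_map_of_square (chartInterHom k N i j) (bijective_chartInterHom i j)
    (bijective_chartHom j).2 (chartInterHom_comp_left i j) (chartInterHom_comp_right i j)
    (I.ideal_le_comap_ideal (chartInter_le_left i j)) (I.map_ideal (chartInter_le_right i j)) ht

/-- A section over `D₊(X_i)` extends to a section over `D₊(X_j)` after multiplication by a power of
`X_i`. -/
lemma IsSectionOn.exists_pow_mul (h : IsSectionOn I i n f) (j : Fin (N + 1)) :
    ∃ s, IsSectionOn I j (s + n) (X i ^ s * f) := by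
  obtain ⟨hf, hfI⟩ := h
  have hf' : f ∈ homogeneousSubmodule (Fin (N + 1)) k n := by simpa using hf
  have h₁ := awayMap_mem_map I i j hfI
  have hXn : (X i : CoordRing k N) ^ n ∈ homogeneousSubmodule (Fin (N + 1)) k (n • 1) := by
    simpa using (isHomogeneous_X k i).pow n
  set α := HomogeneousLocalization.awayMap
    (homogeneousSubmodule (Fin (N + 1)) k) (X_mem i) (mul_comm (X i) (X j)) with hα
  have h₂ : α (HomogeneousLocalization.Away.mk _ (X_mem j) n f hf) =
      α (HomogeneousLocalization.Away.mk _ (X_mem j) n (X i ^ n) hXn) *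
      HomogeneousLocalization.awayMap (homogeneousSubmodule (Fin (N + 1)) k) (X_mem j)
        (rfl : (X i * X j : CoordRing k N) = X i * X j)
        (HomogeneousLocalization.Away.mk _ (X_mem i) n f hf) := by
    apply HomogeneousLocalization.val_injective
    rw [HomogeneousLocalization.val_mul, hα]
    simp only [HomogeneousLocalization.awayMap_mk, HomogeneousLocalization.Away.val_mk,
      Localization.mk_mul]
    rw [Localization.mk_eq_mk_iff, Localization.r_iff_exists]
    refine ⟨1, ?_⟩
    simp only [OneMemClass.coe_one, one_mul, Submonoid.coe_mul]
    ring
  have h₃ : α (HomogeneousLocalization.Away.mk _ (X_mem j) n f hf) ∈ (chartIdeal I j).map α := by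
    rw [h₂]
    exact Ideal.mul_mem_left _ _ h₁
  let := α.toAlgebra
  have hloc := HomogeneousLocalization.Away.isLocalization_mul (X_mem (k := k) j) (X_mem i)
    (mul_comm (X i) (X j)) one_ne_zero
  obtain ⟨_, ⟨s, rfl⟩, hs⟩ := (IsLocalization.algebraMap_mem_map_algebraMap_iff
    (Submonoid.powers (HomogeneousLocalization.Away.isLocalizationElem (X_mem (k := k) j)
      (X_mem i))) _ _ _).1 h₃
  refine ⟨s, ?_, ?_⟩
  · simpa using ((isHomogeneous_X k i).pow s).mul hf'
  · convert hs using 1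
    apply HomogeneousLocalization.val_injective
    simp [HomogeneousLocalization.Away.val_mk, Localization.mk_mul, Localization.mk_pow, pow_add]

lemma IsSectionOn.exists_pow_mul_mem (h : IsSectionOn I i n f) : ∃ s, X i ^ s * f ∈ satIdeal I := by
  choose s hs using h.exists_pow_mul
  refine ⟨Finset.univ.sup s, ?_⟩
  have hX : ∀ m, (X i : CoordRing k N) ^ m ∈ homogeneousSubmodule (Fin (N + 1)) k m := fun m => by
    simpa using (isHomogeneous_X k i).pow m
  rw [mem_satIdeal_iff_of_mem (IsHomogeneous.mul (hX _) h.mem)]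
  intro j
  have hle : s j ≤ Finset.univ.sup s := Finset.le_sup (Finset.mem_univ j)
  have := (hs j).mul (hX (Finset.univ.sup s - s j))
  rwa [← mul_assoc, ← pow_add, ← add_assoc, Nat.sub_add_cancel hle] at this

/-- The support of a closed subscheme is the zero locus of its saturated ideal. -/
lemma mem_support_iff_satIdeal_le {x : ProjSpace k N} :
    x ∈ I.support ↔ satIdeal I ≤ x.asHomogeneousIdeal.toIdeal := by
  obtain ⟨i, hi⟩ : ∃ i, (X i : CoordRing k N) ∉ x.asHomogeneousIdeal.toIdeal := by
    by_contra! hcon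
    refine x.not_irrelevant_le ?_
    change (HomogeneousIdeal.irrelevant _).toIdeal ≤ x.asHomogeneousIdeal.toIdeal
    rw [irrelevant_eq_idealOfVars, idealOfVars, Ideal.span_le]
    rintro _ ⟨i, rfl⟩
    exact hcon i
  have hx : x ∈ (chart k N i).1 := hi
  rw [Scheme.IdealSheafData.mem_support_iff_of_mem hx, Scheme.mem_zeroLocus_iff]
  constructor
  · intro h f hf
    rw [← sum_homogeneousComponent f]
    refine Ideal.sum_mem _ fun n _ => ?_
    obtain ⟨hn, hnI⟩ := mem_satIdeal_iff.1 hf n i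
    by_contra hcon
    exact h _ hnI ((mem_basicOpen_chartHom_iff hx hn).2 hcon)
  · intro h s hs hxs
    obtain ⟨t, rfl⟩ := (bijective_chartHom i).2 s
    obtain ⟨n, f, hf, rfl⟩ := HomogeneousLocalization.Away.mk_surjective _ (X_mem i) t
    obtain ⟨m, hm⟩ := IsSectionOn.exists_pow_mul_mem (I := I) (i := i) (n := n) (f := f) ⟨hf, hs⟩
    have hfx := (mem_basicOpen_chartHom_iff hx hf).1 hxs
    exact (x.isPrime.mem_or_mem (h hm)).elim (fun h => hi (x.isPrime.mem_of_pow_mem _ h)) hfx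

end ClosedSubscheme

namespace ClosedSubscheme

variable {k : Type u} [Field k] {N : ℕ}

lemma specializes_iff_le {x y : ProjSpace k N} :
    x ⤳ y ↔ x.asHomogeneousIdeal.toIdeal ≤ y.asHomogeneousIdeal.toIdeal := by
  rw [specializes_iff_mem_closure]
  exact (ProjectiveSpectrum.le_iff_mem_closure
    (𝒜 := homogeneousSubmodule (Fin (N + 1)) k) x y).symm

/-- The points of a closed subscheme, as homogeneous primes containing its saturated ideal. -/
def pointsEquiv (I : ClosedSubscheme k N) : I.subscheme ≃ ProjPoints (satIdeal I) :=
  Equiv.ofBijective (fun x => ⟨I.subschemeι x, mem_support_iff_satIdeal_le.1 (by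
    have : I.subschemeι x ∈ Set.range I.subschemeι := ⟨x, rfl⟩
    rw [Scheme.IdealSheafData.range_subschemeι] at this
    exact this)⟩) <| by
  constructor
  · intro x y h
    have h' : I.subschemeι x = I.subschemeι y :=
      congrArg (fun p : ProjPoints (satIdeal I) => p.1) h
    exact I.subschemeι.isEmbedding.injective h'
  · rintro ⟨x, hx⟩
    have : x ∈ (I.support : Set (ProjSpace k N)) := mem_support_iff_satIdeal_le.2 hx
    rw [← Scheme.IdealSheafData.range_subschemeι] at this
    obtain ⟨y, rfl⟩ := this
    exact ⟨y, rfl⟩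

lemma topologicalKrullDim_subscheme (I : ClosedSubscheme k N) :
    topologicalKrullDim I.subscheme = Order.krullDim (ProjPoints (satIdeal I)) := by
  rw [← Order.krullDim_orderDual]
  let e : TopologicalSpace.IrreducibleCloseds I.subscheme ≃ (ProjPoints (satIdeal I))ᵒᵈ :=
    irreducibleSetEquivPoints.toEquiv.trans ((pointsEquiv I).trans OrderDual.toDual)
  refine Order.krullDim_eq_of_orderIso ⟨e, ?_⟩
  intro s t
  rw [← irreducibleSetEquivPoints.le_iff_le]
  exact (specializes_iff_le.symm.trans I.subschemeι.isEmbedding.isInducing.specializes_iff)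

variable {I : ClosedSubscheme k N} {c : ℕ}

lemma HasCodim.krullDim_eq (h : HasCodim I c) :
    c ≤ N ∧ Order.krullDim (ProjPoints (satIdeal I)) = ((N - c : ℕ) : WithBot ℕ∞) := by
  rw [HasCodim, topologicalKrullDim_subscheme] at h
  generalize Order.krullDim (ProjPoints (satIdeal I)) = d at h
  induction d with
  | bot => simp at h
  | coe d =>
    have h : d + c = N := by exact_mod_cast h
    induction d using ENat.recTopCoe with
    | top => simp at h
    | coe d =>
      have h : d + c = N := by exact_mod_cast h
      exact ⟨by omega, by rw [show N - c = d by omega]; rfl⟩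

lemma HasCodim.dim_eq (h : HasCodim I c) : dim I = N - c := by
  rw [dim, topologicalKrullDim_subscheme, h.krullDim_eq.2]
  rfl

lemma HasCodim.length_le (h : HasCodim I c) (p : LTSeries (ProjPoints (satIdeal I))) :
    p.length ≤ N - c := by
  have := Order.LTSeries.length_le_krullDim p
  rw [h.krullDim_eq.2] at this
  exact_mod_cast this

lemma HasCodim.exists_length_eq (h : HasCodim I c) :
    ∃ p : LTSeries (ProjPoints (satIdeal I)), p.length = N - c := by
  exact Order.le_krullDim_iff.1 h.krullDim_eq.2.ge

lemma HasCodim.satIdeal_le (h : HasCodim I c) : satIdeal I ≤ idealOfVars (Fin (N + 1)) k := by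
  obtain ⟨p, -⟩ := h.exists_length_eq
  refine le_idealOfVars (isHomogeneous_satIdeal I) fun htop => p.head.1.isPrime.ne_top ?_
  exact top_le_iff.1 (htop ▸ p.head.2)

end ClosedSubscheme

section Differences

lemma firstDiff_iterate_sub (r : ℕ) (f g : ℤ → ℤ) :
    firstDiff^[r] (fun n => f n - g n) = fun n => firstDiff^[r] f n - firstDiff^[r] g n := by
  induction r generalizing f g with
  | zero => rfl
  | succ r ih =>
    simp only [Function.iterate_succ_apply]
    rw [← ih]
    congr 1
    funext n
    simp only [firstDiff]
    ring

lemma firstDiff_iterate_of_neg (r : ℕ) {f : ℤ → ℤ} (hf : ∀ n < 0, f n = 0) :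
    ∀ n < 0, firstDiff^[r] f n = 0 := by
  induction r generalizing f with
  | zero => exact hf
  | succ r ih =>
    rw [Function.iterate_succ_apply]
    refine ih fun n hn => ?_
    rw [firstDiff, hf n hn, hf (n - 1) (by omega), sub_zero]

lemma primitive_firstDiff {f : ℤ → ℤ} (hf : ∀ n < 0, f n = 0) : primitive (firstDiff f) = f := by
  have hf' : ∀ n < 0, firstDiff f n = 0 := firstDiff_iterate_of_neg 1 hf
  funext n
  rw [primitive]
  rcases lt_or_ge n 0 with hn | hn
  · rw [hf n hn]
    refine finsum_mem_eq_zero_of_forall_eq_zero fun k hk => hf' k ?_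
    exact lt_of_le_of_lt hk hn
  · obtain ⟨n, rfl⟩ := Int.eq_ofNat_of_zero_le hn
    rw [finsum_mem_eq_sum_of_inter_support_eq (t := (Finset.range (n + 1)).image Nat.cast) (f := firstDiff f),
      Finset.sum_image (by intro a _ b _ h; exact_mod_cast h)]
    · clear hn
      induction n with
      | zero => simp [firstDiff, hf (-1) (by norm_num)]
      | succ n ih =>
        rw [Finset.sum_range_succ, ih, firstDiff]
        push_cast
        rw [add_sub_cancel_right]
        ring
    · ext m
      simp only [Set.mem_inter_iff, Set.mem_Iic, Function.mem_support, Finset.coe_image,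
        Set.mem_image, Finset.mem_coe, Finset.mem_range]
      refine and_congr_left fun hm => ⟨fun h => ?_, ?_⟩
      · have : 0 ≤ m := by
          by_contra hcon
          exact hm (hf' m (by omega))
        exact ⟨m.toNat, by omega, by omega⟩
      · rintro ⟨j, hj, rfl⟩
        omega

end Differences

section NoetherNormalization

variable {σ : Type} {k : Type u} [Field k]

lemma sub_C_mem_span_of_mem_adjoin {s : Set (MvPolynomial σ k)}
    (hs : ∀ y ∈ s, y ∈ homogeneousSubmodule σ k 1) {a : MvPolynomial σ k}
    (ha : a ∈ Algebra.adjoin k s) : a - C (constantCoeff a) ∈ Ideal.span s := by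
  induction ha using Algebra.adjoin_induction with
  | mem x hx =>
    have : constantCoeff x = 0 := by
      rw [constantCoeff_eq]
      exact mem_idealOfVars_iff.1 (mem_idealOfVars_of_mem (hs x hx))
    rw [this, C_0, sub_zero]
    exact Ideal.subset_span hx
  | algebraMap r => simp [algebraMap_eq]
  | add x y _ _ hx hy =>
    rw [map_add, C_add, add_sub_add_comm]
    exact Ideal.add_mem _ hx hy
  | mul x y _ _ hx hy =>
    have : x * y - C (constantCoeff (x * y)) =
        y * (x - C (constantCoeff x)) + C (constantCoeff x) * (y - C (constantCoeff y)) := by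
      rw [map_mul, C_mul]
      ring
    rw [this]
    exact Ideal.add_mem _ (Ideal.mul_mem_left _ _ hx) (Ideal.mul_mem_left _ _ hy)

/-- If the coordinate ring of a closed subscheme is finite over a ring generated by linear forms,
these have no common zero on the subscheme. -/
lemma idealOfVars_le_radical_of_finite {I : Ideal (MvPolynomial σ k)}
    (hI : I.IsHomogeneous (homogeneousSubmodule σ k)) {s : Set (MvPolynomial σ k)}
    (hs : ∀ y ∈ s, y ∈ homogeneousSubmodule σ k 1)
    (hfin : Module.Finite (Algebra.adjoin k s) (MvPolynomial σ k ⧸ I)) :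
    idealOfVars σ k ≤ (I ⊔ Ideal.span s).radical := by
  rw [idealOfVars, Ideal.span_le]
  rintro _ ⟨i, rfl⟩
  have hint : IsIntegral (Algebra.adjoin k s) (Ideal.Quotient.mk I (X i)) :=
    Algebra.IsIntegral.isIntegral _
  obtain ⟨p, hp, hpi⟩ := hint
  set Q := I ⊔ Ideal.span s with hQdef
  have hQ : Q.IsHomogeneous (homogeneousSubmodule σ k) :=
    hI.sup (Ideal.homogeneous_span _ _ fun y hy => ⟨1, hs y hy⟩)
  let φ : Algebra.adjoin k s →+* k := constantCoeff.comp (Algebra.adjoin k s).val.toRingHom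
  have hφ : (Ideal.Quotient.factor (le_sup_left : I ≤ Q)).comp
      (algebraMap (Algebra.adjoin k s) (MvPolynomial σ k ⧸ I)) =
      ((Ideal.Quotient.mk Q).comp C).comp φ := by
    ext a
    change Ideal.Quotient.mk Q (a : MvPolynomial σ k) = Ideal.Quotient.mk Q (C (constantCoeff a.1))
    rw [Ideal.Quotient.eq]
    exact Ideal.mem_sup_right (sub_C_mem_span_of_mem_adjoin hs a.2)
  have h₁ := congrArg (Ideal.Quotient.factor (le_sup_left : I ≤ Q)) hpi
  rw [Polynomial.hom_eval₂, hφ, map_zero, Ideal.Quotient.factor_mk, ← Polynomial.eval₂_map,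
    ← Polynomial.hom_eval₂, Ideal.Quotient.eq_zero_iff_mem, Polynomial.eval₂_eq_sum_range] at h₁
  set q := p.map φ with hq
  have hqm : q.Monic := hp.map φ
  refine ⟨q.natDegree, ?_⟩
  have h₂ := isHomogeneous_ideal_iff.1 hQ _ h₁ q.natDegree
  have hXm : ∀ m, (X i : MvPolynomial σ k) ^ m ∈ homogeneousSubmodule σ k m := fun m => by
    simpa using (isHomogeneous_X k i).pow m
  rw [map_sum, Finset.sum_range_succ, Finset.sum_eq_zero, zero_add] at h₂
  · rwa [homogeneousComponent_C_mul, homogeneousComponent_self (hXm _), hqm.coeff_natDegree,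
      C_1, one_mul] at h₂
  · intro m hm
    rw [homogeneousComponent_C_mul, homogeneousComponent_of_mem (hXm m),
      if_neg (by have := Finset.mem_range.1 hm; omega), mul_zero]

lemma RegularOn.linearIndependent {ys : List (MvPolynomial σ k)} {K : Ideal (MvPolynomial σ k)}
    (hK : K ≤ idealOfVars σ k) (hys : ∀ y ∈ ys, y ∈ homogeneousSubmodule σ k 1)
    (hreg : RegularOn ⊤ K ys) : LinearIndependent k ys.get := by
  rw [Fintype.linearIndependent_iff]
  intro c hc
  refine hreg.eq_zero_of_sum_mem hK hys c ?_
  simp only [← smul_eq_C_mul, hc]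
  exact K.zero_mem

lemma ideal_span_eq_of_span_eq {s t : Set (MvPolynomial σ k)}
    (h : Submodule.span k s = Submodule.span k t) : Ideal.span s = Ideal.span t := by
  have := congrArg (fun V : Submodule k (MvPolynomial σ k) => 
    Ideal.span (V : Set (MvPolynomial σ k))) h
  simpa only [Ideal.span, Submodule.span_span_of_tower] using this

lemma adjoin_eq_of_span_eq {s t : Set (MvPolynomial σ k)}
    (h : Submodule.span k s = Submodule.span k t) : Algebra.adjoin k s = Algebra.adjoin k t := by
  rw [← Algebra.adjoin_span, h, Algebra.adjoin_span]

lemma exists_span_append_singleton {ys : List (MvPolynomial σ k)}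
    (hys : LinearIndependent k ys.get) {r : ℕ} {l : Fin r → MvPolynomial σ k}
    (hl : LinearIndependent k l) (hr : ys.length + 1 = r)
    (hmem : ∀ y ∈ ys, y ∈ Submodule.span k (Set.range l)) :
    ∃ z, Submodule.span k {y | y ∈ ys ++ [z]} = Submodule.span k (Set.range l) := by
  set V := Submodule.span k (Set.range l) with hV
  have hVfin : FiniteDimensional k V := FiniteDimensional.span_of_finite k (Set.finite_range l)
  have hVr : Module.finrank k V = r := by rw [hV, finrank_span_eq_card hl, Fintype.card_fin]
  have hW : Module.finrank k (Submodule.span k {y | y ∈ ys}) = ys.length := by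
    rw [← Set.range_list_get, finrank_span_eq_card hys, Fintype.card_fin]
  have hWV : Submodule.span k {y | y ∈ ys} ≤ V := Submodule.span_le.2 hmem
  obtain ⟨z, hzV, hz⟩ : ∃ z ∈ V, z ∉ Submodule.span k {y | y ∈ ys} := by
    by_contra! hcon
    have := le_antisymm hWV hcon
    rw [this] at hW
    omega
  have hle : Submodule.span k {y | y ∈ ys ++ [z]} ≤ V := by
    refine Submodule.span_le.2 fun y hy => ?_
    rcases List.mem_append.1 hy with hy | hy
    · exact hmem y hy
    · rw [List.mem_singleton.1 hy]
      exact hzV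
  refine ⟨z, Submodule.eq_of_le_of_finrank_le hle ?_⟩
  have hfin : FiniteDimensional k (Submodule.span k {y | y ∈ ys ++ [z]}) :=
    Submodule.finiteDimensional_of_le hle
  have hlt : Submodule.span k {y | y ∈ ys} < Submodule.span k {y | y ∈ ys ++ [z]} := by
    refine lt_of_le_not_ge (Submodule.span_mono fun y hy => List.mem_append_left _ hy) fun h =>
      hz (h (Submodule.subset_span ?_))
    simp
  have := Submodule.finrank_lt_finrank_of_lt hlt
  omega

end NoetherNormalization

namespace ClosedSubscheme

variable {k : Type u} [Field k] {N : ℕ} {X Y : ClosedSubscheme k N}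

lemma isLinearNoetherNormalization_of_regularOn (hY : satIdeal Y ≤ idealOfVars (Fin (N + 1)) k)
    {ys : List (CoordRing k N)} (hys : ∀ y ∈ ys, y ∈ homogeneousSubmodule (Fin (N + 1)) k 1)
    (hrad : idealOfVars (Fin (N + 1)) k ≤ (satIdeal Y ⊔ Ideal.ofList ys).radical)
    (hreg : RegularOn ⊤ (satIdeal Y) ys) : IsLinearNoetherNormalization Y ys.get := by
  classical
  have htop : (⊤ : Ideal (CoordRing k N)).IsHomogeneous (homogeneousSubmodule (Fin (N + 1)) k) :=
    Ideal.IsHomogeneous.top _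
  obtain ⟨ι, _, f, d, hf⟩ := exists_isGradedBasis htop ys (satIdeal Y) le_top
    (isHomogeneous_satIdeal Y) hys hreg (exists_forall_mem_sup_mul htop le_top hrad)
  have hA : subringOf ys.get = Algebra.adjoin k {y | y ∈ ys} := by
    rw [subringOf, Set.range_list_get]
  refine ⟨fun i => hys _ (List.get_mem _ _), hreg.linearIndependent hY hys, ?_, ?_⟩
  · obtain ⟨j⟩ : Nonempty ι := by
      by_contra hcon
      have hempty : IsEmpty ι := not_nonempty_iff.1 hcon
      obtain ⟨c, -, hc⟩ := hf.spanning 1 trivial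
      rw [Finset.univ_eq_empty, Finset.sum_empty, sub_zero] at hc
      have := mem_idealOfVars_iff.1 (hY hc)
      simp at this
    rw [injective_iff_map_eq_zero]
    intro c hc
    have hcY : (c : CoordRing k N) ∈ satIdeal Y := Ideal.Quotient.eq_zero_iff_mem.1 hc
    have := hf.independent (Pi.single j (c : CoordRing k N)) (fun i => ?_) ?_ j
    · rw [Pi.single_eq_same] at this
      exact Subtype.ext this
    · rw [← hA]
      by_cases hij : i = j
      · subst hij
        rw [Pi.single_eq_same]
        exact c.2
      · rw [Pi.single_eq_of_ne hij]
        exact Subalgebra.zero_mem _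
    · rw [Finset.sum_eq_single j (fun i _ hij => by rw [Pi.single_eq_of_ne hij, zero_mul])
        (fun h => absurd (Finset.mem_univ j) h), Pi.single_eq_same]
      exact Ideal.mul_mem_right _ _ hcY
  · refine Module.Finite.of_surjective (Fintype.linearCombination (subringOf ys.get)
      (fun j => Ideal.Quotient.mk (satIdeal Y) (f j))) fun x => ?_
    obtain ⟨g, rfl⟩ := Ideal.Quotient.mk_surjective x
    obtain ⟨c, hcA, hc⟩ := hf.spanning g trivial
    refine ⟨fun j => ⟨c j, by rw [hA]; exact hcA j⟩, ?_⟩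
    rw [Fintype.linearCombination_apply]
    have : Ideal.Quotient.mk (satIdeal Y) g =
        Ideal.Quotient.mk (satIdeal Y) (∑ j, c j * f j) := Ideal.Quotient.eq.2 hc
    rw [this, map_sum]
    refine Finset.sum_congr rfl fun j _ => ?_
    rw [map_mul]
    rfl

lemma relIdealIsFree_of_isGradedBasis {r : ℕ}
    {l : Fin r → CoordRing k N} {zs : List (CoordRing k N)}
    (hA : Algebra.adjoin k {y | y ∈ zs} = subringOf l) {ι : Type} [Fintype ι]
    {f : ι → CoordRing k N} {d : ι → ℕ}
    (hf : IsGradedBasis zs (satIdeal X) (satIdeal Y) f d) :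
    RelIdealIsFree X Y l fun n => Nat.card {j : ι // (d j : ℤ) = n} := by
  have hmk : Function.Surjective (Ideal.Quotient.mk (satIdeal Y)) := Ideal.Quotient.mk_surjective
  let v : ι → relIdeal X Y := fun j =>
    ⟨Ideal.Quotient.mk (satIdeal Y) (f j), Ideal.mem_map_of_mem _ (hf.mem j)⟩
  let π : relIdeal X Y →ₗ[subringOf l] CoordRing k N ⧸ satIdeal Y :=
    (relIdeal X Y).subtype.restrictScalars (subringOf l)
  have hπ : ∀ c : ι → subringOf l, π (∑ j, c j • v j) =
      Ideal.Quotient.mk (satIdeal Y) (∑ j, (c j : CoordRing k N) * f j) := by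
    intro c
    rw [map_sum, map_sum]
    refine Finset.sum_congr rfl fun j _ => ?_
    rw [map_mul, map_smul]
    rfl
  have hli : LinearIndependent (subringOf l) v := by
    rw [Fintype.linearIndependent_iff]
    intro c hc j
    have h₁ := hπ c
    rw [hc, map_zero, eq_comm, Ideal.Quotient.eq_zero_iff_mem] at h₁
    exact Subtype.ext (hf.independent (fun j => (c j : CoordRing k N))
      (fun j => by rw [hA]; exact (c j).2) h₁ j)
  have hsp : ⊤ ≤ Submodule.span (subringOf l) (Set.range v) := by
    rintro ⟨x, hx⟩ -
    obtain ⟨g, hg, rfl⟩ := (Ideal.mem_map_iff_of_surjective _ hmk).1 hx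
    obtain ⟨c, hcA, hc⟩ := hf.spanning g hg
    let c' : ι → subringOf l := fun j => ⟨c j, by rw [← hA]; exact hcA j⟩
    have hsum : (⟨Ideal.Quotient.mk (satIdeal Y) g, hx⟩ : relIdeal X Y) = ∑ j, c' j • v j := by
      apply Subtype.ext
      exact (Ideal.Quotient.eq.2 hc).trans (hπ c').symm
    rw [hsum]
    exact Submodule.sum_mem _ fun j _ => Submodule.smul_mem _ _ (Submodule.subset_span ⟨j, rfl⟩)
  let e := Fintype.equivFin ι
  refine ⟨Fintype.card ι, (Module.Basis.mk hli hsp).reindex e, fun j => d (e.symm j),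
    fun j => ⟨f (e.symm j), hf.homogeneous _, hf.mem _, ?_⟩, fun n => ?_⟩
  · rw [Module.Basis.reindex_apply, Module.Basis.mk_apply]
  · exact Nat.card_congr (e.subtypeEquiv fun j => by simp)

/-- For every linear Noether normalization of `S / I_Y`, the module `I_X / I_Y` has a graded basis
over it. -/
lemma exists_isGradedBasis_of_isLinearNoetherNormalization [Infinite k]
    (hX : IsACM X) (hXc : HasCodim X 3) (hY : IsACM Y) (hYc : HasCodim Y 2)
    (hle : satIdeal Y ≤ satIdeal X) {l : Fin (N - 1) → CoordRing k N}
    (hl : IsLinearNoetherNormalization Y l) :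
    ∃ zs : List (CoordRing k N), zs.length = N - 1 ∧
      Algebra.adjoin k {y | y ∈ zs} = subringOf l ∧
      ∃ (ι : Type) (_ : Fintype ι) (f : ι → CoordRing k N) (d : ι → ℕ),
        IsGradedBasis zs (satIdeal X) (satIdeal Y) f d := by
  have hN := hXc.krullDim_eq.1
  have hlV : Submodule.span k (Set.range l) ≤ homogeneousSubmodule (Fin (N + 1)) k 1 :=
    Submodule.span_le.2 (by rintro _ ⟨i, rfl⟩; exact hl.linear i)
  have hlrad := idealOfVars_le_radical_of_finite (isHomogeneous_satIdeal Y)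
    (by rintro _ ⟨i, rfl⟩; exact hl.linear i) hl.finite
  have hspan : Ideal.span (Submodule.span k (Set.range l) : Set (CoordRing k N)) =
      Ideal.span (Set.range l) := Submodule.span_span_of_tower _ _ _
  obtain ⟨ys, hlen, hysV, hysrad⟩ := exists_linear_parameters (Submodule.span k (Set.range l))
    (N - 2) (satIdeal X) (isHomogeneous_satIdeal X) hlV
    (hlrad.trans (Ideal.radical_mono (by rw [hspan]; exact sup_le_sup_right hle _)))
    (fun p => by have := hXc.length_le p; omega)
  have hyslin : ∀ y ∈ ys, y ∈ homogeneousSubmodule (Fin (N + 1)) k 1 := fun y hy => hlV (hysV y hy)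
  obtain ⟨p, hp⟩ := hXc.exists_length_eq
  have hregX := regularOn_of_isCohenMacaulayRing (isHomogeneous_satIdeal X) hXc.satIdeal_le hX
    hyslin hysrad p (by omega)
  obtain ⟨z, hz⟩ := exists_span_append_singleton
    (hregX.linearIndependent hXc.satIdeal_le hyslin) hl.linearIndependent (by omega) hysV
  have hzlen : (ys ++ [z]).length = N - 1 := by simp; omega
  have hzlin : ∀ y ∈ ys ++ [z], y ∈ homogeneousSubmodule (Fin (N + 1)) k 1 := fun y hy =>
    hlV (hz ▸ Submodule.subset_span hy)
  have hzrad : idealOfVars (Fin (N + 1)) k ≤ (satIdeal Y ⊔ Ideal.ofList (ys ++ [z])).radical := by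
    rw [Ideal.ofList, ideal_span_eq_of_span_eq hz]
    exact hlrad
  obtain ⟨q, hq⟩ := hYc.exists_length_eq
  have hregY := regularOn_of_isCohenMacaulayRing (isHomogeneous_satIdeal Y) hYc.satIdeal_le hY
    hzlin hzrad q (by omega)
  have hreg := RegularOn.of_sup z ys (satIdeal Y) (by rwa [sup_eq_left.2 hle]) hregY
  rw [inf_eq_left.2 hle] at hreg
  exact ⟨ys ++ [z], hzlen, adjoin_eq_of_span_eq hz, exists_isGradedBasis
    (isHomogeneous_satIdeal X) _ _ hle (isHomogeneous_satIdeal Y) hzlin hreg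
    (exists_forall_mem_sup_mul (isHomogeneous_satIdeal X) hle hzrad)⟩

lemma exists_isLinearNoetherNormalization [Infinite k] (hY : IsACM Y) (hYc : HasCodim Y 2) :
    ∃ l : Fin (N - 1) → CoordRing k N, IsLinearNoetherNormalization Y l := by
  have hN := hYc.krullDim_eq.1
  obtain ⟨ys, hlen, hys, hrad⟩ := exists_linear_parameters
    (homogeneousSubmodule (Fin (N + 1)) k 1) (N - 1) (satIdeal Y) (isHomogeneous_satIdeal Y) le_rfl
    (by
      refine le_trans (le_sup_of_le_right ?_) Ideal.le_radical
      rw [idealOfVars, Ideal.span_le]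
      rintro _ ⟨i, rfl⟩
      exact Ideal.subset_span (X_mem i))
    (fun p => by have := hYc.length_le p; omega)
  obtain ⟨p, hp⟩ := hYc.exists_length_eq
  have hreg := regularOn_of_isCohenMacaulayRing (isHomogeneous_satIdeal Y) hYc.satIdeal_le hY
    hys hrad p (by omega)
  rw [← hlen]
  exact ⟨ys.get, isLinearNoetherNormalization_of_regularOn hYc.satIdeal_le hys hrad hreg⟩

lemma postulationChar_sub_primitive (hXc : HasCodim X 3) (hYc : HasCodim Y 2) (n : ℤ) :
    postulationChar X n - primitive (postulationChar Y) n =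
      firstDiff^[N - 1] (fun n => hilbertFun (satIdeal X) n - hilbertFun (satIdeal Y) n) n := by
  have hN := hXc.krullDim_eq.1
  have hneg : ∀ n < 0, hilbertFun (satIdeal Y) n -
      hilbertFun (satIdeal (⊤ : ClosedSubscheme k N)) n = 0 := fun n hn => by
    rw [hilbertFun_of_neg _ hn, hilbertFun_of_neg _ hn, sub_zero]
  have hP : h0Proj k N = hilbertFun (satIdeal (⊤ : ClosedSubscheme k N)) :=
    h0_eq_hilbertFun (by omega) _
  rw [postulationChar, postulationChar, hXc.dim_eq, hYc.dim_eq, hP,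
    h0_eq_hilbertFun (by omega) X, h0_eq_hilbertFun (by omega) Y,
    show N - 3 + 2 = N - 1 by omega, show N - 2 + 2 = N - 1 + 1 by omega,
    Function.iterate_succ', Function.comp_apply,
    primitive_firstDiff (firstDiff_iterate_of_neg _ hneg)]
  simp only [firstDiff_iterate_sub]
  ring

end ClosedSubscheme

end

theorem proposition3p2 {k : Type u} [Field k] [IsAlgClosed k] {N : ℕ}
    (X Y : ClosedSubscheme k N)
    (hX : ClosedSubscheme.IsACM X) (hXcodim : ClosedSubscheme.HasCodim X 3)
    (hY : ClosedSubscheme.IsACM Y) (hYcodim : ClosedSubscheme.HasCodim Y 2)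
    -- `X ⊆ Y` as closed subschemes, i.e. the ideal sheaf of `Y` is contained in that of `X`
    (hXY : Y ≤ X) :
    (∀ n : ℤ, 0 ≤ ClosedSubscheme.postulationChar X n -
      primitive (ClosedSubscheme.postulationChar Y) n) ∧
    (∃ l : Fin (N - 1) → CoordRing k N, ClosedSubscheme.IsLinearNoetherNormalization Y l) ∧
    (∀ l : Fin (N - 1) → CoordRing k N, ClosedSubscheme.IsLinearNoetherNormalization Y l →
      ∃ L : ℤ → ℕ, ClosedSubscheme.RelIdealIsFree X Y l L ∧
        ∀ n : ℤ, ClosedSubscheme.postulationChar X n -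
          primitive (ClosedSubscheme.postulationChar Y) n = (L n : ℤ)) := by
  have hinf : Infinite k := IsAlgClosed.instInfinite
  have hle := ClosedSubscheme.satIdeal_mono hXY
  have hexists := ClosedSubscheme.exists_isLinearNoetherNormalization hY hYcodim
  have hfree : ∀ l : Fin (N - 1) → CoordRing k N,
      ClosedSubscheme.IsLinearNoetherNormalization Y l →
      ∃ L : ℤ → ℕ, ClosedSubscheme.RelIdealIsFree X Y l L ∧
        ∀ n : ℤ, ClosedSubscheme.postulationChar X n -
          primitive (ClosedSubscheme.postulationChar Y) n = (L n : ℤ) := by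
    intro l hl
    obtain ⟨zs, hlen, hA, ι, _, f, d, hf⟩ :=
      ClosedSubscheme.exists_isGradedBasis_of_isLinearNoetherNormalization hX hXcodim hY hYcodim
        hle hl
    refine ⟨_, ClosedSubscheme.relIdealIsFree_of_isGradedBasis hA hf, fun n => ?_⟩
    rw [ClosedSubscheme.postulationChar_sub_primitive hXcodim hYcodim, ← hlen, hf.hilbertFun]
  refine ⟨fun n => ?_, hexists, hfree⟩
  obtain ⟨l, hl⟩ := hexists
  obtain ⟨L, -, hL⟩ := hfree l hl
  rw [hL]
  exact Int.natCast_nonneg _
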